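/- Let $X$ be a compact oriented smooth manifold of dimension $4$ (without boundary) and let $\boldsymbol\omega=(\omega_1,\omega_2,\omega_3)$ be a triple of closed $2$-forms on $X$. Let $\mathbb T=\mathbb R^3/\mathbb Z^3$ with the action of $\{\pm1\}$ by $x\mapsto\pm x$, and let $\theta_1,\theta_2,\theta_3$ be closed $1$-forms on $\mathbb T$ that form a frame of $T^*\mathbb T$ and satisfy $(-1)^*\theta_i=-\theta_i$ (for example, constant $1$-forms). Put $\Theta_1=\theta_2\wedge\theta_3$, $\Theta_2=\theta_3\wedge\theta_1$, $\Theta_3=\theta_1\wedge\theta_2$ and $g_{\boldsymbol\theta}=\theta_1^2+\theta_2^2+\theta_3^2$. A map $f\colon M\to\mathbb T/\{\pm1\}$ from a smooth manifold $M$ (possibly with boundary) is called smooth if every point of $M$ has an open neighbourhood $V$ with a smooth map $\tilde f\colon V\to\mathbb R^3$ such that $f|_V$ is the composition of $\tilde f$ with the projection $\mathbb R^3\to\mathbb T/\{\pm1\}$. For a smooth map $f\colon X\to\mathbb T/\{\pm1\}$, the form $f^*\Theta_j$ and the function $\|df\|^2=\mathrm{tr}_g(f^*g_{\boldsymbol\theta})$,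 for a Riemannian metric $g$ on $X$, are computed on $V$ as $\tilde f^*\Theta_j$ and $\mathrm{tr}_g(\tilde f^*g_{\boldsymbol\theta})$, and the Dirichlet energy is $\mathcal E(f,g,g_{\boldsymbol\theta})=\int_X\|df\|^2\,d\mathrm{vol}_g$. Two smooth maps $f_0,f_1\colon X\to\mathbb T/\{\pm1\}$ are homotopic if there is a smooth map $F\colon[0,1]\times X\to\mathbb T/\{\pm1\}$ with $F(0,\cdot)=f_0$ and $F(1,\cdot)=f_1$. The triple $\boldsymbol\omega$ is a hyper-Kähler triple if the $\omega_i$ are closed and, at every point of $X$, $\omega_1^2=\omega_2^2=\omega_3^2\neq0$ and $\omega_1\wedge\omega_2=\omega_2\wedge\omega_3=\omega_3\wedge\omega_1=0$. In this case $g_{\boldsymbol\omega}$ denotes the Riemannian metric that at each point is the positive definite one of $S_{\boldsymbol\omega}$ and $-S_{\boldsymbol\omega}$, where $\tfrac12S_{\boldsymbol\omega}(u,v)\,\omega_1^2=\iota_u\omega_1\wedge\iota_v\omega_2\wedge\omega_3$. Then the following hold. (i) For $i,j=1,2,3$, the integral $$\mathcal I_{ij}(f,\boldsymbol\omega,\boldsymbol\theta)=\int_X\omega_i\wedge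 f^*\Theta_j$$ is determined by the homotopy class of the smooth map $f\colon X\to\mathbb T/\{\pm1\}$: if $f_0$ and $f_1$ are homotopic, then $\mathcal I_{ij}(f_0,\boldsymbol\omega,\boldsymbol\theta)=\mathcal I_{ij}(f_1,\boldsymbol\omega,\boldsymbol\theta)$. (ii) If $\boldsymbol\omega$ is a hyper-Kähler triple, then every smooth map $f\colon X\to\mathbb T/\{\pm1\}$ satisfies $$\sum_{i=1}^3\mathcal I_{ii}(f,\boldsymbol\omega,\boldsymbol\theta)\le\mathcal E(f,g_{\boldsymbol\omega},g_{\boldsymbol\theta}).$$ This holds for either orientation of $X$, in particular for the one given by $\omega_1^2$. -/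

import Mathlib

open scoped Manifold Topology

/-- The order of smoothness of `C^∞` objects. -/
local notation "∞" => ((⊤ : ℕ∞) : WithTop ℕ∞)

noncomputable section

/-- The model space `ℝ⁴` of the 4-manifold; it is also the model of its tangent spaces. -/
abbrev E4 : Type := EuclideanSpace ℝ (Fin 4)

/-- The universal cover `ℝ³` of the torus. -/
abbrev E3 : Type := EuclideanSpace ℝ (Fin 3)

/-! ### Exterior algebra -/

/-- The wedge product of alternating forms, normalised as the sum over shuffles, so that
`(α ∧ β) (u, v) = α u * β v - α v * β u` for 1-forms. -/
def wedge {V : Type*} [AddCommGroup V] [Module ℝ V] {k l : ℕ}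
    (α : V [⋀^Fin k]→ₗ[ℝ] ℝ) (β : V [⋀^Fin l]→ₗ[ℝ] ℝ) : V [⋀^Fin (k + l)]→ₗ[ℝ] ℝ :=
  ((LinearMap.mul' ℝ ℝ).compAlternatingMap (α.domCoprod β)).domDomCongr finSumFinEquiv

/-- `SU(2)`-structures on `ℝ⁴`: triples of 2-forms with `ω₁² = ω₂² = ω₃² ≠ 0` and
`ω₁ ∧ ω₂ = ω₂ ∧ ω₃ = ω₃ ∧ ω₁ = 0`. -/
structure IsSU2Structure (ω : Fin 3 → E4 [⋀^Fin 2]→ₗ[ℝ] ℝ) : Prop where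
  sq_eq : ∀ i j, wedge (ω i) (ω i) = wedge (ω j) (ω j)
  sq_ne_zero : ∀ i, wedge (ω i) (ω i) ≠ 0
  wedge_eq_zero : ∀ i j, i ≠ j → wedge (ω i) (ω j) = 0

/-- The standard basis of `ℝ⁴`. -/
def stdBasis4 : Module.Basis (Fin 4) ℝ E4 := (EuclideanSpace.basisFun (Fin 4) ℝ).toBasis

/-- The tensor `S_ω` given by `(1/2) S_ω(u, v) ω₁² = ι_u ω₁ ∧ ι_v ω₂ ∧ ω₃`. Two top-degree forms
are compared through their values on one basis; their ratio does not depend on the basis. -/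
def tripleTensor (ω : Fin 3 → E4 [⋀^Fin 2]→ₗ[ℝ] ℝ) (u v : E4) : ℝ :=
  2 * (wedge (wedge ((ω 0).curryLeft u) ((ω 1).curryLeft v)) (ω 2) : E4 [⋀^Fin 4]→ₗ[ℝ] ℝ) stdBasis4
    / (wedge (ω 0) (ω 0) : E4 [⋀^Fin 4]→ₗ[ℝ] ℝ) stdBasis4

open Classical in
/-- The metric `g_ω` of an `SU(2)`-structure: `S_ω` if `S_ω` is positive, and `-S_ω` otherwise. -/
def tripleMetric (ω : Fin 3 → E4 [⋀^Fin 2]→ₗ[ℝ] ℝ) (u v : E4) : ℝ :=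
  if ∀ w : E4, w ≠ 0 → 0 < tripleTensor ω w w then tripleTensor ω u v else -tripleTensor ω u v

/-- The trace `tr_g q = g^{ab} q_{ab}` of a symmetric bilinear form `q` with respect to a
metric `g`; it does not depend on the basis. -/
def metricTrace (g q : E4 → E4 → ℝ) : ℝ :=
  Matrix.trace ((Matrix.of fun a b => g (stdBasis4 a) (stdBasis4 b))⁻¹ *
    Matrix.of fun a b => q (stdBasis4 a) (stdBasis4 b))

/-! ### Differential forms and integration on 4-manifolds -/

section Manifold

variable {X : Type*} [TopologicalSpace X] [ChartedSpace E4 X]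

variable (X) in
/-- `X` is oriented by its atlas: the coordinate changes have positive Jacobian determinant. -/
def IsOrientedAtlas [IsManifold (𝓡 4) ∞ X] : Prop :=
  haveI : IsManifold (𝓡 4) 1 X := IsManifold.of_le (n := ∞) (by decide)
  ∀ c c' x : X, x ∈ (chartAt E4 c).source → x ∈ (chartAt E4 c').source →
    0 < (tangentCoordChange (𝓡 4) c c' x).det

/-- The derivative at `y` of the inverse of the chart around `c`. -/
def chartSymmDeriv (c : X) (y : E4) :
    E4 →L[ℝ] TangentSpace (𝓡 4) ((extChartAt (𝓡 4) c).symm y) :=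
  mfderiv 𝓘(ℝ, E4) (𝓡 4) (extChartAt (𝓡 4) c).symm y

/-- A `k`-form read in the chart around `c`, that is, pulled back by the inverse of the chart. -/
def formInChart {k : ℕ} (ω : (x : X) → (TangentSpace (𝓡 4) x) [⋀^Fin k]→L[ℝ] ℝ) (c : X) (y : E4) :
    E4 [⋀^Fin k]→L[ℝ] ℝ :=
  (ω ((extChartAt (𝓡 4) c).symm y)).compContinuousLinearMap (chartSymmDeriv c y)

/-- Smooth closed differential `k`-forms on `X`. -/
structure IsClosedForm {k : ℕ} (ω : (x : X) → (TangentSpace (𝓡 4) x) [⋀^Fin k]→L[ℝ] ℝ) :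
    Prop where
  smooth : ∀ c : X, ContDiffOn ℝ ∞ (formInChart ω c) (extChartAt (𝓡 4) c).target
  closed : ∀ c : X, ∀ y ∈ (extChartAt (𝓡 4) c).target, extDeriv (formInChart ω c) y = 0

/-- A triple of 2-forms at a point, as a triple of algebraic alternating forms on `ℝ⁴`, the
space on which all tangent spaces are modelled. -/
def tripleAt (ω : Fin 3 → (x : X) → (TangentSpace (𝓡 4) x) [⋀^Fin 2]→L[ℝ] ℝ) (x : X) :
    Fin 3 → E4 [⋀^Fin 2]→ₗ[ℝ] ℝ :=
  fun i => (ω i x).toAlternatingMap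

/-- Hyper-Kähler triples: triples of closed 2-forms that form an `SU(2)`-structure on every
tangent space. -/
structure IsHyperKahlerTriple
    (ω : Fin 3 → (x : X) → (TangentSpace (𝓡 4) x) [⋀^Fin 2]→L[ℝ] ℝ) : Prop where
  closed : ∀ i, IsClosedForm (ω i)
  isSU2Structure : ∀ x, IsSU2Structure (tripleAt ω x)

variable [IsManifold (𝓡 4) ∞ X] [CompactSpace X] [T2Space X]

variable (X) in
/-- A smooth partition of unity subordinate to the charts. -/
def chartPartition : SmoothPartitionOfUnity X (𝓡 4) X Set.univ :=
  (SmoothPartitionOfUnity.exists_isSubordinate_chartAt_source (𝓡 4) X).choose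

variable (X) in
theorem chartPartition_isSubordinate :
    (chartPartition X).IsSubordinate (fun x => (chartAt E4 x).source) :=
  (SmoothPartitionOfUnity.exists_isSubordinate_chartAt_source (𝓡 4) X).choose_spec

/-- The integral over `X` of an object `D` of top degree that assigns a number to every frame:
`∑_c ∫ ρ_c D(∂₁, ∂₂, ∂₃, ∂₄) dy¹dy²dy³dy⁴`, where `ρ` is a partition of unity subordinate to the
charts. It is independent of choices if `D` is a 4-form and the atlas is oriented, and if `D` is
a density. -/
def integralTop (D : (x : X) → (Fin 4 → TangentSpace (𝓡 4) x) → ℝ) : ℝ :=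
  ∑ᶠ c : X, ∫ y in (extChartAt (𝓡 4) c).target,
    chartPartition X c ((extChartAt (𝓡 4) c).symm y) *
      D ((extChartAt (𝓡 4) c).symm y) (fun a => chartSymmDeriv c y (stdBasis4 a))

/-- The integral `∫_X Ω` of a 4-form. -/
def integralForm (Ω : (x : X) → (TangentSpace (𝓡 4) x) [⋀^Fin 4]→ₗ[ℝ] ℝ) : ℝ :=
  integralTop fun x v => Ω x v

/-- The integral `∫_X h dvol_g` of a function against the Riemannian volume
`√(det g_{ab}) dy¹dy²dy³dy⁴`. -/
def integralVol (g : (x : X) → TangentSpace (𝓡 4) x → TangentSpace (𝓡 4) x → ℝ) (h : X → ℝ) : ℝ :=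
  integralTop fun x v => h x * √(Matrix.det (Matrix.of fun a b => g x (v a) (v b)))

end Manifold

/-! ### The orbifold `T³/{±1}` -/

/-- The orbifold `T/{±1}`, where `T = (ℝ/ℤ)³` and `-1` acts by `x ↦ -x`. -/
abbrev TorusQuot : Type := MulAction.orbitRel.Quotient ℤˣ (UnitAddTorus (Fin 3))

/-- The universal covering `ℝ³ → T`. -/
def torusMk (x : E3) : UnitAddTorus (Fin 3) := fun i => (x i : UnitAddCircle)

/-- The composition `ℝ³ → T → T/{±1}`, a global orbifold chart. -/
def orbProj (x : E3) : TorusQuot := Quotient.mk'' (torusMk x)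

/-- Smooth maps `M → T/{±1}` (morphisms of orbifolds) from a manifold, possibly with boundary:
maps that locally lift to smooth maps into `ℝ³`. -/
structure SmoothOrbMap {E H : Type*} [NormedAddCommGroup E] [NormedSpace ℝ E] [TopologicalSpace H]
    (I : ModelWithCorners ℝ E H) (M : Type*) [TopologicalSpace M] [ChartedSpace H M] where
  /-- the underlying map -/
  toFun : M → TorusQuot
  exists_lift : ∀ p : M, ∃ F : M → E3, ∃ V : Set M, IsOpen V ∧ p ∈ V ∧
    ContMDiffOn I 𝓘(ℝ, E3) ∞ F V ∧ ∀ x ∈ V, orbProj (F x) = toFun x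

/-- A smooth lift of `f` to `ℝ³` on a neighbourhood of `p`. -/
def SmoothOrbMap.lift {E H : Type*} [NormedAddCommGroup E] [NormedSpace ℝ E] [TopologicalSpace H]
    {I : ModelWithCorners ℝ E H} {M : Type*} [TopologicalSpace M] [ChartedSpace H M]
    (f : SmoothOrbMap I M) (p : M) : M → E3 :=
  (f.exists_lift p).choose

/-- `f₀ ∼ f₁`: there is a smooth map `F : [0,1] × X → T/{±1}` with `F(0, ·) = f₀` and
`F(1, ·) = f₁`. -/
def SmoothOrbMap.Homotopic {X : Type*} [TopologicalSpace X] [ChartedSpace E4 X]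
    (f₀ f₁ : SmoothOrbMap (𝓡 4) X) : Prop :=
  ∃ F : SmoothOrbMap ((𝓡∂ 1).prod (𝓡 4)) (unitInterval × X),
    (∀ x, F.toFun (0, x) = f₀.toFun x) ∧ ∀ x, F.toFun (1, x) = f₁.toFun x

/-- A frame `θ = (θ₁, θ₂, θ₃)` of `T*T` by closed 1-forms with `(-1)^* θᵢ = -θᵢ` (as holds for
constant 1-forms), so that the products `θᵢ ∧ θⱼ` and the flat metric `θ₁² + θ₂² + θ₃²` are
`{±1}`-invariant. A 1-form on `T` is given by its pullback to `ℝ³`. -/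
structure TorusCoframe where
  /-- the 1-forms on `ℝ³` -/
  form : Fin 3 → E3 → E3 [⋀^Fin 1]→L[ℝ] ℝ
  smooth : ∀ i, ContDiff ℝ ∞ (form i)
  periodic : ∀ i x y, torusMk x = torusMk y → form i x = form i y
  odd : ∀ i x, (form i (-x)).compContinuousLinearMap (-ContinuousLinearMap.id ℝ E3) = -form i x
  closed : ∀ i x, extDeriv (form i) x = 0
  linearIndependent : ∀ x, LinearIndependent ℝ fun i => form i x

/-- `Θⱼ = θₖ ∧ θₗ` for `(j, k, l)` a cyclic permutation of `(1, 2, 3)`. -/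
def TorusCoframe.bigTheta (θ : TorusCoframe) (j : Fin 3) (x : E3) : E3 [⋀^Fin 2]→ₗ[ℝ] ℝ :=
  wedge (θ.form (j + 1) x).toAlternatingMap (θ.form (j + 2) x).toAlternatingMap

/-- The metric `g_θ = θ₁² + θ₂² + θ₃²`. -/
def TorusCoframe.metric (θ : TorusCoframe) (x u v : E3) : ℝ :=
  ∑ i, θ.form i x ![u] * θ.form i x ![v]

/-! ### The integrals and the energy -/

section Energy

variable {X : Type*} [TopologicalSpace X] [ChartedSpace E4 X]

/-- The derivative at `x` of a local lift of `f` around `x`. -/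
def SmoothOrbMap.liftDeriv (f : SmoothOrbMap (𝓡 4) X) (x : X) : TangentSpace (𝓡 4) x →L[ℝ] E3 :=
  mfderiv (𝓡 4) 𝓘(ℝ, E3) (f.lift x) x

/-- The pullback `f^*Θ` of a `{±1}`-invariant form on `T`, computed in local lifts of `f`. -/
def SmoothOrbMap.pullback (f : SmoothOrbMap (𝓡 4) X) {k : ℕ} (Θ : E3 → E3 [⋀^Fin k]→ₗ[ℝ] ℝ)
    (x : X) : (TangentSpace (𝓡 4) x) [⋀^Fin k]→ₗ[ℝ] ℝ :=
  (Θ (f.lift x x)).compLinearMap (f.liftDeriv x).toLinearMap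

/-- `‖df‖² = tr_g (f^* g_θ)`. -/
def SmoothOrbMap.normSqDeriv (f : SmoothOrbMap (𝓡 4) X)
    (g : (x : X) → TangentSpace (𝓡 4) x → TangentSpace (𝓡 4) x → ℝ) (θ : TorusCoframe)
    (x : X) : ℝ :=
  metricTrace (g x) fun u v => θ.metric (f.lift x x) (f.liftDeriv x u) (f.liftDeriv x v)

variable [IsManifold (𝓡 4) ∞ X] [CompactSpace X] [T2Space X]

/-- `I_ij(f, ω, θ) = ∫_X ω_i ∧ f^*Θ_j`. -/
def SmoothOrbMap.pairing (f : SmoothOrbMap (𝓡 4) X)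
    (ω : Fin 3 → (x : X) → (TangentSpace (𝓡 4) x) [⋀^Fin 2]→L[ℝ] ℝ) (θ : TorusCoframe)
    (i j : Fin 3) : ℝ :=
  integralForm fun x => wedge (ω i x).toAlternatingMap (f.pullback (θ.bigTheta j) x)

/-- The Dirichlet energy `E(f, g, g_θ) = ∫_X ‖df‖² dvol_g`. -/
def SmoothOrbMap.energy (f : SmoothOrbMap (𝓡 4) X)
    (g : (x : X) → TangentSpace (𝓡 4) x → TangentSpace (𝓡 4) x → ℝ) (θ : TorusCoframe) : ℝ :=
  integralVol g (f.normSqDeriv g θ)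

end Energy

end

/-!
Both parts are computed in charts, with the partition of unity `ρ` that defines the integrals.

A map to `T/{±1}` has local lifts to `ℝ³`. Two lifts of the same map need not differ by an element
of `ℤ³ ⋊ {±1}` near a fixed point of `-1`, but at each point they do to first order
(`IsLiftAt.exists_sign`): in every direction one of the two signs relates the derivatives, and a
vector space is not the union of two proper subspaces. As the `θᵢ` are periodic and odd, the
pullbacks `Φ^*Θⱼ` and `Φ^*g_θ`, being quadratic in the `θᵢ`, do not depend on the lift. Hence they
are natural and have the regularity of pullbacks by smooth maps, and `Φ^*Θⱼ` is closed
(`IsLiftAt.fderiv_orbTwoForm_cyclic`).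

*Homotopy invariance.* Reparametrised by a smooth step function, a homotopy becomes a family `F`
over `ℝ` without boundary. Let `β` be the restriction of `F^*Θⱼ` to the slices `t = const` and
`γ = ι_{∂ₜ} F^*Θⱼ`. Then `∂ₜ β = dγ` (`IsSmoothFamily.fderiv_time`), and since `ω` is closed the
derivative of the pairing is `∑_c ∫ ρ_c d(ω ∧ γ)`. Integration by parts in each chart turns this
into `-∑_c ∫ ω ∧ dρ_c ∧ γ` (`IsSmoothFamily.integral_cutoff_time`). Inserting `∑_m ρ_m = 1` and
changing variables from the chart `c` to the chart `m`, where orientedness of the atlas enters, the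
sum becomes `-∑_m ∫ ρ_m ω ∧ (∑_c dρ_c) ∧ γ = 0` (`IsSmoothFamily.sum_integral_fluxForm`).

*Energy bound.* The inequality holds pointwise (`IsSU2Structure.abs_topSum_le`). The Clifford
relations between skew `4 × 4` matrices and their Hodge duals give every `SU(2)`-structure a frame
in which it is a multiple of the standard triple (`exists_adapted_frame`). Both sides scale alike
under linear maps, and in the adapted frame the inequality is `2 x y ≤ x² + y²`, applied to products
of coefficients (`abs_topSum_le_standard`). Since the left-hand side is bounded in absolute value,
the orientation plays no role. The integration needs the energy density to be continuous; the
formula `IsSU2Structure.energyDensity_eq` removes the case distinction in the sign of `S_ω`.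
-/

noncomputable section

/-! ### Exterior algebra -/

section Wedge

variable {V W : Type*} [AddCommGroup V] [Module ℝ V] [AddCommGroup W] [Module ℝ W]

/-- The wedge product as a sum over all permutations instead of shuffles. -/
theorem wedge_smul_factorial {k l : ℕ} (α : V [⋀^Fin k]→ₗ[ℝ] ℝ) (β : V [⋀^Fin l]→ₗ[ℝ] ℝ)
    (v : Fin (k + l) → V) :
    ((k.factorial * l.factorial : ℕ) : ℝ) * wedge α β v =
      ∑ σ : Equiv.Perm (Fin (k + l)), (Equiv.Perm.sign σ : ℤ) *
        (α (fun i => v (σ (Fin.castAdd l i))) * β (fun i => v (σ (Fin.natAdd k i)))) := by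
  have h := MultilinearMap.domCoprod_alternization_eq α β
  have h2 := congrArg (fun F => LinearMap.mul' ℝ ℝ (F (v ∘ finSumFinEquiv))) h
  simp only [MultilinearMap.alternatization_apply, AlternatingMap.smul_apply, map_sum] at h2
  rw [wedge, AlternatingMap.domDomCongr_apply, LinearMap.compAlternatingMap_apply]
  simp only [Fintype.card_fin] at h2
  rw [← nsmul_eq_mul, ← map_nsmul]
  refine h2.symm.trans ?_
  refine Fintype.sum_equiv (finSumFinEquiv.permCongr) _ _ fun σ => ?_
  rw [Equiv.Perm.sign_permCongr]
  simp [Units.smul_def, Equiv.permCongr_apply, ← zsmul_eq_mul]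

theorem sum_perm_fin_succ {n : ℕ} (f : Equiv.Perm (Fin (n + 1)) → ℝ) :
    ∑ σ, f σ = ∑ i, ∑ τ, f (Equiv.Perm.decomposeFin.symm (i, τ)) := by
  rw [← Equiv.Perm.decomposeFin.symm.sum_comp, Fintype.sum_prod_type]

theorem alternating_one_eta (α : V [⋀^Fin 1]→ₗ[ℝ] ℝ) (v : Fin 1 → V) : α v = α ![v 0] := by
  congr 1; ext i; fin_cases i; rfl

theorem alternating_two_eta (α : V [⋀^Fin 2]→ₗ[ℝ] ℝ) (v : Fin 2 → V) : α v = α ![v 0, v 1] := by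
  congr 1; ext i; fin_cases i <;> rfl

theorem alternating_two_swap (α : V [⋀^Fin 2]→ₗ[ℝ] ℝ) (u v : V) : α ![u, v] = - α ![v, u] := by
  have := α.map_swap ![v, u] (i := 0) (j := 1) (by decide)
  rw [← this]; congr 1; ext i; fin_cases i <;> simp

theorem decomposeFin_symm_apply_two {n : ℕ} (p : Fin (n + 3)) (e : Equiv.Perm (Fin (n + 2))) :
    Equiv.Perm.decomposeFin.symm (p, e) 2 = Equiv.swap 0 p (e 1).succ :=
  Equiv.Perm.decomposeFin_symm_apply_succ e p 1

theorem decomposeFin_symm_apply_three {n : ℕ} (p : Fin (n + 4)) (e : Equiv.Perm (Fin (n + 3))) :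
    Equiv.Perm.decomposeFin.symm (p, e) 3 = Equiv.swap 0 p (e 2).succ :=
  Equiv.Perm.decomposeFin_symm_apply_succ e p 2

theorem wedge_one_one_apply (α β : V [⋀^Fin 1]→ₗ[ℝ] ℝ) (v : Fin 2 → V) :
    wedge α β v = α ![v 0] * β ![v 1] - α ![v 1] * β ![v 0] := by
  have h := wedge_smul_factorial α β v
  have hα : ∀ f : Fin 1 → Fin 2, α (fun i => v (f i)) = α ![v (f 0)] := fun f =>
    alternating_one_eta α _
  have hβ : ∀ f : Fin 1 → Fin 2, β (fun i => v (f i)) = β ![v (f 0)] := fun f =>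
    alternating_one_eta β _
  simp only [Nat.reduceAdd, hα, hβ] at h
  simp [sum_perm_fin_succ, Fin.sum_univ_succ] at h
  linarith

theorem wedge_two_two_apply (α β : V [⋀^Fin 2]→ₗ[ℝ] ℝ) (v : Fin 4 → V) :
    wedge α β v = α ![v 0, v 1] * β ![v 2, v 3] - α ![v 0, v 2] * β ![v 1, v 3] +
      α ![v 0, v 3] * β ![v 1, v 2] + α ![v 1, v 2] * β ![v 0, v 3] -
      α ![v 1, v 3] * β ![v 0, v 2] + α ![v 2, v 3] * β ![v 0, v 1] := by
  -- expand the sum over the permutations of `Fin 4` explicitly and sort all arguments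
  have h := wedge_smul_factorial α β v
  have hα : ∀ f : Fin 2 → Fin 4, α (fun i => v (f i)) = α ![v (f 0), v (f 1)] := fun f =>
    alternating_two_eta α _
  have hβ : ∀ f : Fin 2 → Fin 4, β (fun i => v (f i)) = β ![v (f 0), v (f 1)] := fun f =>
    alternating_two_eta β _
  simp only [Nat.reduceAdd, hα, hβ] at h
  simp [sum_perm_fin_succ, Fin.sum_univ_succ, decomposeFin_symm_apply_two,
    decomposeFin_symm_apply_three, Equiv.swap_apply_def] at h
  rw [alternating_two_swap α (v 1) (v 0), alternating_two_swap α (v 2) (v 0),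
    alternating_two_swap α (v 3) (v 0), alternating_two_swap α (v 2) (v 1),
    alternating_two_swap α (v 3) (v 1), alternating_two_swap α (v 3) (v 2),
    alternating_two_swap β (v 1) (v 0), alternating_two_swap β (v 2) (v 0),
    alternating_two_swap β (v 3) (v 0), alternating_two_swap β (v 2) (v 1),
    alternating_two_swap β (v 3) (v 1), alternating_two_swap β (v 3) (v 2)] at h
  linarith

theorem wedge_compLinearMap_one_one (α β : V [⋀^Fin 1]→ₗ[ℝ] ℝ) (L : W →ₗ[ℝ] V) :
    (wedge α β).compLinearMap L = wedge (α.compLinearMap L) (β.compLinearMap L) := by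
  ext v
  rw [wedge_one_one_apply, AlternatingMap.compLinearMap_apply, wedge_one_one_apply]
  simp only [AlternatingMap.compLinearMap_apply]
  have : ∀ a : W, (fun i => L (![a] i)) = ![L a] := fun a => by ext i; fin_cases i; rfl
  simp only [this]

theorem wedge_compLinearMap_two_two (α β : V [⋀^Fin 2]→ₗ[ℝ] ℝ) (L : W →ₗ[ℝ] V) :
    (wedge α β).compLinearMap L = wedge (α.compLinearMap L) (β.compLinearMap L) := by
  ext v
  rw [wedge_two_two_apply, AlternatingMap.compLinearMap_apply, wedge_two_two_apply]
  have : ∀ a b : W, (fun i => L (![a, b] i)) = ![L a, L b] := fun a b => by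
    ext i; fin_cases i <;> rfl
  simp only [AlternatingMap.compLinearMap_apply, this]

/-- Pullback of a top-degree form by `L` multiplies it by `det L`. -/
theorem alternating_comp_basis {ι : Type*} [Fintype ι] [DecidableEq ι] (b : Module.Basis ι ℝ V)
    (D : V [⋀^ι]→ₗ[ℝ] ℝ) (L : V →ₗ[ℝ] V) :
    D (fun a => L (b a)) = LinearMap.det L * D b := by
  have h := D.eq_smul_basis_det b
  have h2 : D (fun a => L (b a)) = D b * b.det (fun a => L (b a)) := by
    conv_lhs => rw [h]
    rfl
  rw [h2, ← Function.comp_def L b, b.det_comp, b.det_self]; ring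

end Wedge

/-! ### Skew-symmetric `4 × 4` matrices and adapted frames -/

section

open Matrix

/-- The Hodge dual of a skew-symmetric `4 × 4` matrix. -/
def dualMatrix (A : Matrix (Fin 4) (Fin 4) ℝ) : Matrix (Fin 4) (Fin 4) ℝ :=
  !![0, A 2 3, -A 1 3, A 1 2; -A 2 3, 0, A 0 3, -A 0 2;
    A 1 3, -A 0 3, 0, A 0 1; -A 1 2, A 0 2, -A 0 1, 0]

/-- The polarised Pfaffian of a pair of skew-symmetric `4 × 4` matrices, normalised as the
coefficient of the wedge product of the corresponding 2-forms, so that its diagonal values are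
twice the Pfaffian. -/
def pfaffianPair (A B : Matrix (Fin 4) (Fin 4) ℝ) : ℝ :=
  A 0 1 * B 2 3 - A 0 2 * B 1 3 + A 0 3 * B 1 2 + A 1 2 * B 0 3 - A 1 3 * B 0 2 + A 2 3 * B 0 1

theorem skew_eq {A : Matrix (Fin 4) (Fin 4) ℝ} (hA : Aᵀ = -A) :
    A = !![0, A 0 1, A 0 2, A 0 3; -A 0 1, 0, A 1 2, A 1 3;
      -A 0 2, -A 1 2, 0, A 2 3; -A 0 3, -A 1 3, -A 2 3, 0] := by
  have h : ∀ i j, A j i = -A i j := fun i j => by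
    simpa using congrFun (congrFun hA i) j
  have hd : ∀ i, A i i = 0 := fun i => by linarith [h i i]
  ext i j
  fin_cases i <;> fin_cases j <;> first | exact h _ _ | exact hd _ | rfl

theorem dualMatrix_transpose (A : Matrix (Fin 4) (Fin 4) ℝ) : (dualMatrix A)ᵀ = -dualMatrix A := by
  ext i j
  fin_cases i <;> fin_cases j <;> simp [dualMatrix]

/-- The polarisation of `A Ã = -Pf(A)`, where `Ã` is the Hodge dual of `A`. This is the Clifford
relation of the quadratic form `Pf`. -/
theorem mul_dualMatrix_add {A B : Matrix (Fin 4) (Fin 4) ℝ} (hA : Aᵀ = -A) (hB : Bᵀ = -B) :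
    A * dualMatrix B + B * dualMatrix A = -pfaffianPair A B • (1 : Matrix (Fin 4) (Fin 4) ℝ) := by
  rw [skew_eq hA, skew_eq hB]
  ext i j
  fin_cases i <;> fin_cases j <;>
    simp [dualMatrix, pfaffianPair] <;> ring

theorem dualMatrix_mul_add {A B : Matrix (Fin 4) (Fin 4) ℝ} (hA : Aᵀ = -A) (hB : Bᵀ = -B) :
    dualMatrix A * B + dualMatrix B * A = -pfaffianPair A B • (1 : Matrix (Fin 4) (Fin 4) ℝ) := by
  have h := congrArg Matrix.transpose (mul_dualMatrix_add hA hB)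
  simpa [Matrix.transpose_mul, dualMatrix_transpose, hA, hB, add_comm] using h

theorem mulVec_dotProduct_eq (M : Matrix (Fin 4) (Fin 4) ℝ) (u z : Fin 4 → ℝ) :
    (M *ᵥ u) ⬝ᵥ z = u ⬝ᵥ Mᵀ *ᵥ z := by
  rw [Matrix.dotProduct_mulVec, Matrix.vecMul_transpose]

theorem dotProduct_mulVec_self_of_skew {A : Matrix (Fin 4) (Fin 4) ℝ} (hA : Aᵀ = -A)
    (u : Fin 4 → ℝ) : u ⬝ᵥ A *ᵥ u = 0 := by
  have h : u ⬝ᵥ A *ᵥ u = u ⬝ᵥ Aᵀ *ᵥ u := by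
    rw [← mulVec_dotProduct_eq, dotProduct_comm]
  rw [hA] at h
  simp [Matrix.neg_mulVec] at h
  linarith

theorem exists_dotProduct_mulVec_ne_zero {R : Matrix (Fin 4) (Fin 4) ℝ} (hR : Rᵀ = R)
    (h0 : R ≠ 0) : ∃ u : Fin 4 → ℝ, u ⬝ᵥ R *ᵥ u ≠ 0 := by
  by_contra! h
  apply h0
  ext i j
  have e : ∀ i j, Pi.single i 1 ⬝ᵥ R *ᵥ Pi.single j 1 = R i j := fun i j => by simp
  have h1 := h (Pi.single i 1 + Pi.single j 1)
  simp only [Matrix.mulVec_add, dotProduct_add, add_dotProduct, e] at h1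
  have h2 := h (Pi.single i 1); have h3 := h (Pi.single j 1)
  rw [e] at h2 h3
  have h4 : R j i = R i j := congrFun (congrFun hR i) j
  simp only [Matrix.zero_apply]; linarith

/-- The coefficients of the standard triple `e⁰¹ + e²³, e⁰² + e³¹, e⁰³ + e¹²`. -/
def stdTriple : Fin 3 → Matrix (Fin 4) (Fin 4) ℝ :=
  ![!![0, 1, 0, 0; -1, 0, 0, 0; 0, 0, 0, 1; 0, 0, -1, 0],
    !![0, 0, 1, 0; 0, 0, 0, -1; -1, 0, 0, 0; 0, 1, 0, 0],
    !![0, 0, 0, 1; 0, 0, 1, 0; 0, -1, 0, 0; -1, 0, 0, 0]]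

set_option linter.unusedSimpArgs false in
/-- Skew matrices satisfying the `SU(2)` relations are a multiple of the standard triple in a
suitable frame. By the Clifford relations the products `Ãⱼ Aₖ`, with `Ã` the Hodge dual of `A`, are
multiples of the imaginary quaternions `I`, `J`, `K`. The matrix `A₀ Ã₁ A₂` is symmetric and
nonzero, hence there is a vector `u` on which its quadratic form does not vanish, and the frame is
`u, Iu, Ju, Ku`. -/
theorem exists_adapted_frame {A : Fin 3 → Matrix (Fin 4) (Fin 4) ℝ} (hA : ∀ i, (A i)ᵀ = -A i)
    {p : ℝ} (hp : p ≠ 0) (hpp : ∀ i, pfaffianPair (A i) (A i) = 2 * p)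
    (hpq : ∀ i j, i ≠ j → pfaffianPair (A i) (A j) = 0) :
    ∃ (r : ℝ) (f : Fin 4 → Fin 4 → ℝ), r ≠ 0 ∧
      ∀ i a b, f a ⬝ᵥ A i *ᵥ f b = r * stdTriple i a b := by
  have hsq : ∀ i, A i * dualMatrix (A i) = (-p) • 1 := fun i => by
    have := mul_dualMatrix_add (hA i) (hA i)
    rw [hpp, ← two_smul ℝ, neg_smul, mul_smul, ← smul_neg] at this
    rw [neg_smul]
    exact smul_right_injective _ (two_ne_zero' ℝ) this
  have hsq' : ∀ i, dualMatrix (A i) * A i = (-p) • 1 := fun i => by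
    have := dualMatrix_mul_add (hA i) (hA i)
    rw [hpp, ← two_smul ℝ, neg_smul, mul_smul, ← smul_neg] at this
    rw [neg_smul]
    exact smul_right_injective _ (two_ne_zero' ℝ) this
  have hanti : ∀ i j, i ≠ j → A i * dualMatrix (A j) = -(A j * dualMatrix (A i)) := fun i j h => by
    have := mul_dualMatrix_add (hA i) (hA j)
    rw [hpq i j h, neg_zero, zero_smul] at this
    exact eq_neg_of_add_eq_zero_left this
  have hanti' : ∀ i j, i ≠ j → dualMatrix (A i) * A j = -(dualMatrix (A j) * A i) :=
    fun i j h => by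
    have := dualMatrix_mul_add (hA i) (hA j)
    rw [hpq i j h, neg_zero, zero_smul] at this
    exact eq_neg_of_add_eq_zero_left this
  have hD := fun i => dualMatrix_transpose (A i)
  -- the relations among triple products
  have hiji : ∀ i j, i ≠ j → A i * dualMatrix (A j) * A i = p • A j := fun i j h => by
    rw [hanti i j h, neg_mul, mul_assoc, hsq']; simp
  have hjik : ∀ i j k, i ≠ j → A j * dualMatrix (A i) * A k = -(A i * dualMatrix (A j) * A k) :=
    fun i j k h => by rw [hanti j i h.symm, neg_mul]
  have hikj : ∀ i j k, j ≠ k → A i * dualMatrix (A k) * A j = -(A i * dualMatrix (A j) * A k) :=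
    fun i j k h => by rw [mul_assoc, hanti' k j h.symm, mul_neg, mul_assoc]
  set R := A 0 * dualMatrix (A 1) * A 2 with hR
  have h102 : A 1 * dualMatrix (A 0) * A 2 = -R := hjik 0 1 2 (by decide)
  have h021 : A 0 * dualMatrix (A 2) * A 1 = -R := hikj 0 1 2 (by decide)
  have h120 : A 1 * dualMatrix (A 2) * A 0 = R := by
    rw [hikj 1 0 2 (by decide), h102, neg_neg]
  have h201 : A 2 * dualMatrix (A 0) * A 1 = R := by
    rw [hjik 0 2 1 (by decide), h021, neg_neg]
  have h210 : A 2 * dualMatrix (A 1) * A 0 = -R := by rw [hjik 1 2 0 (by decide), h120]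
  have hRsymm : Rᵀ = R := by
    rw [hR, Matrix.transpose_mul, Matrix.transpose_mul, hA, hA, hD]
    simp only [neg_mul, mul_neg, neg_neg]
    rw [← mul_assoc, h210, neg_neg]
  -- `R` has an inverse up to the factor `-p³`
  have hR0 : R ≠ 0 := by
    intro h
    have : R * (dualMatrix (A 2) * A 1 * dualMatrix (A 0)) = (-p * -p * -p) • 1 := by
      calc _ = A 0 * (dualMatrix (A 1) * (A 2 * dualMatrix (A 2)) * A 1) * dualMatrix (A 0) := by
            rw [hR]; noncomm_ring
        _ = _ := by
            rw [hsq]; simp [hsq, hsq', smul_smul]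
    rw [h, zero_mul] at this
    have h00 := congrFun (congrFun this 0) 0
    simp [hp] at h00
  obtain ⟨u, hu⟩ := exists_dotProduct_mulVec_ne_zero hRsymm hR0
  let N : Fin 4 → Matrix (Fin 4) (Fin 4) ℝ := ![1, p⁻¹ • (dualMatrix (A 1) * A 2),
    p⁻¹ • (dualMatrix (A 2) * A 0), p⁻¹ • (dualMatrix (A 0) * A 1)]
  have hself := fun i => dotProduct_mulVec_self_of_skew (hA i) u
  refine ⟨p⁻¹ * (u ⬝ᵥ R *ᵥ u), fun a => N a *ᵥ u, mul_ne_zero (inv_ne_zero hp) hu, ?_⟩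
  have hQ : ∀ i a b, (N a *ᵥ u) ⬝ᵥ A i *ᵥ (N b *ᵥ u) = u ⬝ᵥ ((N a)ᵀ * A i * N b) *ᵥ u := by
    intro i a b
    rw [mulVec_dotProduct_eq]; simp [Matrix.mulVec_mulVec, mul_assoc]
  have hskew : ∀ i a b, (N a *ᵥ u) ⬝ᵥ A i *ᵥ (N b *ᵥ u) = -((N b *ᵥ u) ⬝ᵥ A i *ᵥ (N a *ᵥ u)) := by
    intro i a b
    rw [dotProduct_comm, mulVec_dotProduct_eq, hA, Matrix.neg_mulVec, dotProduct_neg]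
  have hdiag : ∀ i a, (N a *ᵥ u) ⬝ᵥ A i *ᵥ (N a *ᵥ u) = 0 := fun i a =>
    dotProduct_mulVec_self_of_skew (hA i) _
  have e1 : ∀ i X, A i * (dualMatrix (A i) * X) = (-p) • X := fun i X => by
    rw [← mul_assoc, hsq]; simp
  have e2 : ∀ i X, dualMatrix (A i) * (A i * X) = (-p) • X := fun i X => by
    rw [← mul_assoc, hsq']; simp
  have e3 : ∀ X, A 2 * (dualMatrix (A 1) * (A 2 * X)) = p • (A 1 * X) := fun X => by
    rw [← mul_assoc, ← mul_assoc, hiji 2 1 (by decide)]; simp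
  simp only [mul_assoc] at hiji h102 h021 h120 h201 h210 hR
  have h012 := hR.symm
  have hupper : ∀ i a b, a < b →
      (N a *ᵥ u) ⬝ᵥ A i *ᵥ (N b *ᵥ u) = p⁻¹ * (u ⬝ᵥ R *ᵥ u) * stdTriple i a b := by
    intro i a b hab
    rw [hQ]
    fin_cases i <;> fin_cases a <;> fin_cases b <;>
      first
      | exact absurd hab (by decide)
      | (simp only [N, stdTriple, Fin.mk_zero, Fin.mk_one, Fin.reduceFinMk, Matrix.cons_val,
          Matrix.transpose_smul, Matrix.transpose_mul, Matrix.transpose_one, hA, hD, neg_mul_neg,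
          one_mul, mul_one, Matrix.smul_mul, Matrix.mul_smul, mul_assoc]
         -- cancelling adjacent dual pairs comes first, so as not to break up the other products
         try simp only [e1, e2, e3, Matrix.mul_smul]
         try simp only [e1, e2, Matrix.mul_smul, hiji _ _ (show (0 : Fin 3) ≠ 1 by decide),
          hiji _ _ (show (0 : Fin 3) ≠ 2 by decide), hiji _ _ (show (1 : Fin 3) ≠ 0 by decide),
          hiji _ _ (show (1 : Fin 3) ≠ 2 by decide), hiji _ _ (show (2 : Fin 3) ≠ 0 by decide),
          hiji _ _ (show (2 : Fin 3) ≠ 1 by decide), h102, h021, h120, h201, h210, h012, hsq',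
          Matrix.smul_mulVec, Matrix.neg_mulVec, dotProduct_smul, dotProduct_neg, hself, smul_neg]
         try simp [hp, hself])
  intro i a b
  rcases lt_trichotomy a b with h | h | h
  · exact hupper i a b h
  · subst h
    rw [hdiag]
    fin_cases i <;> fin_cases a <;> simp [stdTriple]
  · rw [hskew, hupper i b a h]
    have : stdTriple i b a = -stdTriple i a b := by
      fin_cases i <;> fin_cases a <;> fin_cases b <;> simp [stdTriple]
    rw [this]; ring

end

/-! ### `SU(2)`-structures and the pointwise energy inequality -/

section

open Matrix

section TwoForm

variable {V : Type*} [AddCommGroup V] [Module ℝ V]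

theorem alternating_two_add_left (α : V [⋀^Fin 2]→ₗ[ℝ] ℝ) (u u' v : V) :
    α ![u + u', v] = α ![u, v] + α ![u', v] :=
  α.map_vecCons_add ![v] u u'

theorem alternating_two_smul_left (α : V [⋀^Fin 2]→ₗ[ℝ] ℝ) (c : ℝ) (u v : V) :
    α ![c • u, v] = c * α ![u, v] :=
  α.map_vecCons_smul ![v] c u

/-- A 2-form as a bilinear form. -/
def twoFormBilin (α : V [⋀^Fin 2]→ₗ[ℝ] ℝ) : V →ₗ[ℝ] V →ₗ[ℝ] ℝ :=
  LinearMap.mk₂ ℝ (fun u v => α ![u, v]) (alternating_two_add_left α)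
    (alternating_two_smul_left α)
    (fun u v v' => by
      rw [alternating_two_swap, alternating_two_add_left, alternating_two_swap α u v,
        alternating_two_swap α u v']; ring)
    (fun c u v => by
      rw [alternating_two_swap, alternating_two_smul_left, alternating_two_swap α u v]
      simp)

theorem twoFormBilin_apply (α : V [⋀^Fin 2]→ₗ[ℝ] ℝ) (u v : V) :
    twoFormBilin α u v = α ![u, v] := rfl

end TwoForm

theorem bilin_eq_dotProduct (B : E4 →ₗ[ℝ] E4 →ₗ[ℝ] ℝ) (x y : Fin 4 → ℝ) :
    B (∑ a, x a • stdBasis4 a) (∑ a, y a • stdBasis4 a) =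
      x ⬝ᵥ (Matrix.of fun a b => B (stdBasis4 a) (stdBasis4 b)) *ᵥ y := by
  simp only [map_sum, map_smul, LinearMap.sum_apply, LinearMap.smul_apply, smul_eq_mul, dotProduct,
    Matrix.mulVec, Matrix.of_apply, Finset.mul_sum]
  rw [Finset.sum_comm]
  refine Finset.sum_congr rfl fun a _ => Finset.sum_congr rfl fun b _ => by ring

theorem wedge_compLinearMap_apply_basis (α β : E4 [⋀^Fin 2]→ₗ[ℝ] ℝ) (L : E4 →ₗ[ℝ] E4) :
    (wedge (α.compLinearMap L) (β.compLinearMap L) : E4 [⋀^Fin 4]→ₗ[ℝ] ℝ) stdBasis4 =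
      LinearMap.det L * (wedge α β : E4 [⋀^Fin 4]→ₗ[ℝ] ℝ) stdBasis4 := by
  rw [← wedge_compLinearMap_two_two]
  exact alternating_comp_basis stdBasis4 (wedge α β : E4 [⋀^Fin 4]→ₗ[ℝ] ℝ) L

theorem topForm_apply_basis_ne_zero {D : E4 [⋀^Fin 4]→ₗ[ℝ] ℝ} (h : D ≠ 0) : D stdBasis4 ≠ 0 := by
  intro h0
  apply h
  rw [D.eq_smul_basis_det stdBasis4, h0, zero_smul]

theorem compLinearMap_two_apply {V W : Type*} [AddCommGroup V] [Module ℝ V] [AddCommGroup W]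
    [Module ℝ W] (α : V [⋀^Fin 2]→ₗ[ℝ] ℝ) (L : W →ₗ[ℝ] V) (u v : W) :
    α.compLinearMap L ![u, v] = α ![L u, L v] := by
  rw [AlternatingMap.compLinearMap_apply]; congr 1; ext i; fin_cases i <;> rfl

theorem compLinearMap_one_apply {V W : Type*} [AddCommGroup V] [Module ℝ V] [AddCommGroup W]
    [Module ℝ W] (α : V [⋀^Fin 1]→ₗ[ℝ] ℝ) (L : W →ₗ[ℝ] V) (u : W) :
    α.compLinearMap L ![u] = α ![L u] := by
  rw [AlternatingMap.compLinearMap_apply]; congr 1; ext i; fin_cases i; rfl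

/-- Every `SU(2)`-structure is, up to a linear change of coordinates, a multiple of the standard
one. The factor is negative for `SU(2)`-structures for which `S_ω` is negative definite. -/
theorem IsSU2Structure.exists_adapted_map {ω : Fin 3 → E4 [⋀^Fin 2]→ₗ[ℝ] ℝ}
    (h : IsSU2Structure ω) : ∃ (r : ℝ) (L : E4 →ₗ[ℝ] E4), r ≠ 0 ∧ LinearMap.det L ≠ 0 ∧
      ∀ i a b, (ω i).compLinearMap L ![stdBasis4 a, stdBasis4 b] = r * stdTriple i a b := by
  let A : Fin 3 → Matrix (Fin 4) (Fin 4) ℝ := fun i =>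
    Matrix.of fun a b => twoFormBilin (ω i) (stdBasis4 a) (stdBasis4 b)
  have hA : ∀ i, (A i)ᵀ = -A i := fun i => by
    ext a b
    exact alternating_two_swap (ω i) _ _
  have hpf : ∀ i j, (wedge (ω i) (ω j) : E4 [⋀^Fin 4]→ₗ[ℝ] ℝ) stdBasis4 =
    pfaffianPair (A i) (A j) := fun i j => wedge_two_two_apply _ _ _
  have hp0 : pfaffianPair (A 0) (A 0) ≠ 0 := by
    rw [← hpf]; exact topForm_apply_basis_ne_zero (h.sq_ne_zero 0)
  obtain ⟨r, f, hr, hf⟩ := exists_adapted_frame hA (p := pfaffianPair (A 0) (A 0) / 2)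
    (div_ne_zero hp0 two_ne_zero)
    (fun i => by rw [← hpf, ← hpf, h.sq_eq i 0]; ring)
    (fun i j hij => by rw [← hpf, h.wedge_eq_zero i j hij]; rfl)
  let L : E4 →ₗ[ℝ] E4 := stdBasis4.constr ℝ fun a => ∑ b, f a b • stdBasis4 b
  have hL : ∀ a, L (stdBasis4 a) = ∑ b, f a b • stdBasis4 b := fun a => by
    simp [L]
  have key : ∀ i a b, (ω i).compLinearMap L ![stdBasis4 a, stdBasis4 b] =
      r * stdTriple i a b := fun i a b => by
    rw [compLinearMap_two_apply, ← twoFormBilin_apply, hL, hL, bilin_eq_dotProduct]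
    exact hf i a b
  refine ⟨r, L, hr, fun h0 => ?_, key⟩
  -- the pullback of `ω₁²` by `L` is a nonzero multiple of the standard volume form
  have h1 := wedge_compLinearMap_apply_basis (ω 0) (ω 0) L
  rw [h0, zero_mul] at h1
  have h2 := (wedge_two_two_apply ((ω 0).compLinearMap L) ((ω 0).compLinearMap L)
    stdBasis4).symm.trans h1
  simp only [key] at h2
  simp [stdTriple, hr] at h2

theorem tripleTensor_eq (ω : Fin 3 → E4 [⋀^Fin 2]→ₗ[ℝ] ℝ) (u v : E4) :
    tripleTensor ω u v = 2 *
      ((ω 0 ![u, stdBasis4 0] * ω 1 ![v, stdBasis4 1] -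
        ω 0 ![u, stdBasis4 1] * ω 1 ![v, stdBasis4 0]) * ω 2 ![stdBasis4 2, stdBasis4 3]
      - (ω 0 ![u, stdBasis4 0] * ω 1 ![v, stdBasis4 2] -
        ω 0 ![u, stdBasis4 2] * ω 1 ![v, stdBasis4 0]) * ω 2 ![stdBasis4 1, stdBasis4 3]
      + (ω 0 ![u, stdBasis4 0] * ω 1 ![v, stdBasis4 3] -
        ω 0 ![u, stdBasis4 3] * ω 1 ![v, stdBasis4 0]) * ω 2 ![stdBasis4 1, stdBasis4 2]
      + (ω 0 ![u, stdBasis4 1] * ω 1 ![v, stdBasis4 2] -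
        ω 0 ![u, stdBasis4 2] * ω 1 ![v, stdBasis4 1]) * ω 2 ![stdBasis4 0, stdBasis4 3]
      - (ω 0 ![u, stdBasis4 1] * ω 1 ![v, stdBasis4 3] -
        ω 0 ![u, stdBasis4 3] * ω 1 ![v, stdBasis4 1]) * ω 2 ![stdBasis4 0, stdBasis4 2]
      + (ω 0 ![u, stdBasis4 2] * ω 1 ![v, stdBasis4 3] -
        ω 0 ![u, stdBasis4 3] * ω 1 ![v, stdBasis4 2]) * ω 2 ![stdBasis4 0, stdBasis4 1])
      / pfaffianPair (Matrix.of fun a b => ω 0 ![stdBasis4 a, stdBasis4 b])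
          (Matrix.of fun a b => ω 0 ![stdBasis4 a, stdBasis4 b]) := by
  have h1 := wedge_two_two_apply (ω 0) (ω 0) stdBasis4
  have h2 := wedge_two_two_apply (wedge ((ω 0).curryLeft u) ((ω 1).curryLeft v)) (ω 2) stdBasis4
  have h3 : ∀ x y : E4, wedge ((ω 0).curryLeft u) ((ω 1).curryLeft v) ![x, y] =
      ω 0 ![u, x] * ω 1 ![v, y] - ω 0 ![u, y] * ω 1 ![v, x] := fun x y => by
    rw [wedge_one_one_apply]; rfl
  simp only [h3] at h2
  unfold tripleTensor
  congr 1
  · congr 1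

theorem tripleTensor_compLinearMap (ω : Fin 3 → E4 [⋀^Fin 2]→ₗ[ℝ] ℝ) {L : E4 →ₗ[ℝ] E4}
    (hL : LinearMap.det L ≠ 0) (u v : E4) :
    tripleTensor (fun i => (ω i).compLinearMap L) u v = tripleTensor ω (L u) (L v) := by
  have h1 : ((ω 0).compLinearMap L).curryLeft u = ((ω 0).curryLeft (L u)).compLinearMap L := by
    simp
  have h2 : ((ω 1).compLinearMap L).curryLeft v = ((ω 1).curryLeft (L v)).compLinearMap L := by
    simp
  unfold tripleTensor
  rw [h1, h2, ← wedge_compLinearMap_one_one]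
  have h3 := wedge_compLinearMap_apply_basis
    (wedge ((ω 0).curryLeft (L u)) ((ω 1).curryLeft (L v))) (ω 2) L
  have h4 := wedge_compLinearMap_apply_basis (ω 0) (ω 0) L
  refine (congrArg₂ (fun x y => 2 * x / y) h3 h4).trans ?_
  rw [mul_left_comm, mul_div_mul_left _ _ hL]

/-- The tensor `S_ω` as a bundled bilinear map. -/
def tripleBilin (ω : Fin 3 → E4 [⋀^Fin 2]→ₗ[ℝ] ℝ) : E4 →ₗ[ℝ] E4 →ₗ[ℝ] ℝ :=
  LinearMap.mk₂ ℝ (tripleTensor ω)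
    (fun u u' v => by simp only [tripleTensor_eq, alternating_two_add_left]; ring)
    (fun c u v => by simp only [tripleTensor_eq, alternating_two_smul_left, smul_eq_mul]; ring)
    (fun u v v' => by simp only [tripleTensor_eq, alternating_two_add_left]; ring)
    (fun c u v => by simp only [tripleTensor_eq, alternating_two_smul_left, smul_eq_mul]; ring)

open Classical in
/-- The metric `g_ω` as a bundled bilinear map. -/
def tripleMetricBilin (ω : Fin 3 → E4 [⋀^Fin 2]→ₗ[ℝ] ℝ) : E4 →ₗ[ℝ] E4 →ₗ[ℝ] ℝ :=
  if ∀ w : E4, w ≠ 0 → 0 < tripleTensor ω w w then tripleBilin ω else -tripleBilin ω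

theorem tripleMetricBilin_apply (ω : Fin 3 → E4 [⋀^Fin 2]→ₗ[ℝ] ℝ) (u v : E4) :
    tripleMetricBilin ω u v = tripleMetric ω u v := by
  unfold tripleMetricBilin tripleMetric
  split_ifs <;> rfl

theorem tripleMetric_compLinearMap (ω : Fin 3 → E4 [⋀^Fin 2]→ₗ[ℝ] ℝ) {L : E4 →ₗ[ℝ] E4}
    (hL : LinearMap.det L ≠ 0) (u v : E4) :
    tripleMetric (fun i => (ω i).compLinearMap L) u v = tripleMetric ω (L u) (L v) := by
  have hinj : Function.Injective L := (LinearMap.equivOfDetNeZero L hL).injective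
  have hsurj : Function.Surjective L := (LinearMap.equivOfDetNeZero L hL).surjective
  have : (∀ w : E4, w ≠ 0 → 0 < tripleTensor ω (L w) (L w)) ↔
      ∀ w : E4, w ≠ 0 → 0 < tripleTensor ω w w := by
    constructor
    · intro h w hw
      obtain ⟨w, rfl⟩ := hsurj w
      exact h w fun h0 => hw (by rw [h0, map_zero])
    · intro h w hw
      exact h _ fun h0 => hw (hinj (by rw [h0, map_zero]))
  simp only [← tripleTensor_compLinearMap ω hL] at this
  unfold tripleMetric
  rw [tripleTensor_compLinearMap ω hL]
  by_cases h : ∀ w : E4, w ≠ 0 → 0 < tripleTensor ω w w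
  · rw [if_pos (this.2 h), if_pos h]
  · rw [if_neg (fun h' => h (this.1 h')), if_neg h]

theorem bilin_comp_matrix (B : E4 →ₗ[ℝ] E4 →ₗ[ℝ] ℝ) (L : E4 →ₗ[ℝ] E4) :
    (Matrix.of fun a b => B (L (stdBasis4 a)) (L (stdBasis4 b))) =
      (LinearMap.toMatrix stdBasis4 stdBasis4 L)ᵀ *
        (Matrix.of fun a b => B (stdBasis4 a) (stdBasis4 b)) *
        LinearMap.toMatrix stdBasis4 stdBasis4 L := by
  have := LinearMap.toMatrix₂_compl₁₂ stdBasis4 stdBasis4 stdBasis4 stdBasis4 B L L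
  have h2 : ∀ C : E4 →ₗ[ℝ] E4 →ₗ[ℝ] ℝ, LinearMap.toMatrix₂ stdBasis4 stdBasis4 C =
      Matrix.of fun a b => C (stdBasis4 a) (stdBasis4 b) := fun C => by
    ext a b; rw [LinearMap.toMatrix₂_apply]; rfl
  rw [h2, h2] at this
  exact this

/-- The trace `tr_g q` is invariant under changes of basis. -/
theorem metricTrace_comp (B Q : E4 →ₗ[ℝ] E4 →ₗ[ℝ] ℝ) {L : E4 →ₗ[ℝ] E4}
    (hL : LinearMap.det L ≠ 0) :
    metricTrace (fun u v => B (L u) (L v)) (fun u v => Q (L u) (L v)) =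
      metricTrace (fun u v => B u v) (fun u v => Q u v) := by
  unfold metricTrace
  rw [bilin_comp_matrix, bilin_comp_matrix]
  set M := LinearMap.toMatrix stdBasis4 stdBasis4 L
  have hM : IsUnit M.det := by
    rw [LinearMap.det_toMatrix]; exact hL.isUnit
  have hMT : IsUnit (Mᵀ).det := by rwa [Matrix.det_transpose]
  rw [Matrix.mul_inv_rev, Matrix.mul_inv_rev]
  set G := Matrix.of fun a b => B (stdBasis4 a) (stdBasis4 b)
  set K := Matrix.of fun a b => Q (stdBasis4 a) (stdBasis4 b)
  calc _ = Matrix.trace (M⁻¹ * (G⁻¹ * ((Mᵀ)⁻¹ * Mᵀ) * K * M)) := by simp only [mul_assoc]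
    _ = _ := by
      rw [Matrix.nonsing_inv_mul _ hMT, mul_one, Matrix.trace_mul_comm, mul_assoc,
        Matrix.mul_nonsing_inv _ hM, mul_one]

theorem sqrt_det_comp (B : E4 →ₗ[ℝ] E4 →ₗ[ℝ] ℝ) (L : E4 →ₗ[ℝ] E4) :
    √(Matrix.det (Matrix.of fun a b => B (L (stdBasis4 a)) (L (stdBasis4 b)))) =
      |LinearMap.det L| * √(Matrix.det (Matrix.of fun a b => B (stdBasis4 a) (stdBasis4 b))) := by
  rw [bilin_comp_matrix, Matrix.det_mul, Matrix.det_mul, Matrix.det_transpose,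
    LinearMap.det_toMatrix, mul_right_comm, ← sq, Real.sqrt_mul (sq_nonneg _), Real.sqrt_sq_eq_abs]

/-- The energy density `tr_g q · √det g` in the standard frame of `ℝ⁴`, for the metric `g = g_ω`. -/
def energyDensity (ω : Fin 3 → E4 [⋀^Fin 2]→ₗ[ℝ] ℝ) (q : E4 → E4 → ℝ) : ℝ :=
  metricTrace (tripleMetric ω) q *
    √(Matrix.det (Matrix.of fun a b => tripleMetric ω (stdBasis4 a) (stdBasis4 b)))

/-- The sum `∑ᵢ ωᵢ ∧ aⱼ ∧ aₖ` over cyclic `(i, j, k)`, evaluated on the standard frame of `ℝ⁴`. -/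
def topSum (ω : Fin 3 → E4 [⋀^Fin 2]→ₗ[ℝ] ℝ) (a : Fin 3 → E4 [⋀^Fin 1]→ₗ[ℝ] ℝ) : ℝ :=
  ∑ i, (wedge (ω i) (wedge (a (i + 1)) (a (i + 2))) : E4 [⋀^Fin 4]→ₗ[ℝ] ℝ) stdBasis4

/-- The symmetric bilinear form `∑ᵢ aᵢ²`. -/
def sumSq {V : Type*} [AddCommGroup V] [Module ℝ V] (a : Fin 3 → V [⋀^Fin 1]→ₗ[ℝ] ℝ) (u v : V) :
    ℝ :=
  ∑ i, a i ![u] * a i ![v]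

/-- The form `∑ᵢ aᵢ²` on `ℝ⁴` as a bundled bilinear map. -/
def sumSqBilin (a : Fin 3 → E4 [⋀^Fin 1]→ₗ[ℝ] ℝ) : E4 →ₗ[ℝ] E4 →ₗ[ℝ] ℝ :=
  LinearMap.mk₂ ℝ (sumSq a)
    (fun u u' v => by
      simp only [sumSq, ← Finset.sum_add_distrib]
      exact Finset.sum_congr rfl fun i _ => by rw [(a i).map_vecCons_add ![] u u']; ring)
    (fun c u v => by
      simp only [sumSq, Finset.smul_sum]
      exact Finset.sum_congr rfl fun i _ => by
        rw [(a i).map_vecCons_smul ![] c u]; simp only [smul_eq_mul]; ring)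
    (fun u v v' => by
      simp only [sumSq, ← Finset.sum_add_distrib]
      exact Finset.sum_congr rfl fun i _ => by rw [(a i).map_vecCons_add ![] v v']; ring)
    (fun c u v => by
      simp only [sumSq, Finset.smul_sum]
      exact Finset.sum_congr rfl fun i _ => by
        rw [(a i).map_vecCons_smul ![] c v]; simp only [smul_eq_mul]; ring)

theorem sumSq_compLinearMap {V : Type*} [AddCommGroup V] [Module ℝ V]
    (a : Fin 3 → V [⋀^Fin 1]→ₗ[ℝ] ℝ) {W : Type*} [AddCommGroup W] [Module ℝ W]
    (L : W →ₗ[ℝ] V) (u v : W) :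
    sumSq (fun i => (a i).compLinearMap L) u v = sumSq a (L u) (L v) := by
  simp only [sumSq, compLinearMap_one_apply]

theorem energyDensity_compLinearMap (ω : Fin 3 → E4 [⋀^Fin 2]→ₗ[ℝ] ℝ)
    (a : Fin 3 → E4 [⋀^Fin 1]→ₗ[ℝ] ℝ) {L : E4 →ₗ[ℝ] E4} (hL : LinearMap.det L ≠ 0) :
    energyDensity (fun i => (ω i).compLinearMap L) (sumSq fun i => (a i).compLinearMap L) =
      |LinearMap.det L| * energyDensity ω (sumSq a) := by
  have h1 := metricTrace_comp (tripleMetricBilin ω) (sumSqBilin a) hL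
  have h2 := sqrt_det_comp (tripleMetricBilin ω) L
  simp only [tripleMetricBilin_apply, sumSqBilin, LinearMap.mk₂_apply] at h1 h2
  have e1 : tripleMetric (fun i => (ω i).compLinearMap L) =
      fun u v => tripleMetric ω (L u) (L v) := by
    funext u v; exact tripleMetric_compLinearMap ω hL u v
  have e2 : (sumSq fun i => (a i).compLinearMap L) = fun u v => sumSq a (L u) (L v) := by
    funext u v; exact sumSq_compLinearMap a L u v
  unfold energyDensity
  rw [e1, e2, h1, h2]; ring

theorem topSum_compLinearMap (ω : Fin 3 → E4 [⋀^Fin 2]→ₗ[ℝ] ℝ)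
    (a : Fin 3 → E4 [⋀^Fin 1]→ₗ[ℝ] ℝ) (L : E4 →ₗ[ℝ] E4) :
    topSum (fun i => (ω i).compLinearMap L) (fun i => (a i).compLinearMap L) =
      LinearMap.det L * topSum ω a := by
  unfold topSum
  rw [Finset.mul_sum]
  refine Finset.sum_congr rfl fun i _ => ?_
  rw [← wedge_compLinearMap_one_one]
  exact wedge_compLinearMap_apply_basis _ _ _

section Standard

variable {ω : Fin 3 → E4 [⋀^Fin 2]→ₗ[ℝ] ℝ} {r : ℝ}

theorem tripleTensor_standard (hr : r ≠ 0)
    (h : ∀ i a b, ω i ![stdBasis4 a, stdBasis4 b] = r * stdTriple i a b) (a b : Fin 4) :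
    tripleTensor ω (stdBasis4 a) (stdBasis4 b) = if a = b then r else 0 := by
  rw [tripleTensor_eq]
  simp only [h, pfaffianPair, Matrix.of_apply]
  fin_cases a <;> fin_cases b <;> simp [stdTriple] <;> field_simp <;> norm_num

theorem tripleMetric_standard (hr : r ≠ 0)
    (h : ∀ i a b, ω i ![stdBasis4 a, stdBasis4 b] = r * stdTriple i a b) (a b : Fin 4) :
    tripleMetric ω (stdBasis4 a) (stdBasis4 b) = if a = b then |r| else 0 := by
  have hq : ∀ w : E4, tripleTensor ω w w = r * ∑ a, (stdBasis4.repr w a) ^ 2 := fun w => by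
    conv_lhs => rw [← stdBasis4.sum_repr w]
    refine (bilin_eq_dotProduct (tripleBilin ω) _ _).trans ?_
    have : (Matrix.of fun a b => tripleBilin ω (stdBasis4 a) (stdBasis4 b)) =
        r • (1 : Matrix (Fin 4) (Fin 4) ℝ) := by
      ext a b
      refine (tripleTensor_standard hr h a b).trans ?_
      simp [Matrix.one_apply]
    rw [this]
    rw [Matrix.smul_mulVec, Matrix.one_mulVec, dotProduct_smul]
    simp only [smul_eq_mul, dotProduct, sq]
  unfold tripleMetric
  rcases lt_or_gt_of_ne hr with h0 | h0
  · rw [if_neg, tripleTensor_standard hr h, abs_of_neg h0]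
    · split_ifs <;> simp
    · intro hpos
      have h1 := hpos (stdBasis4 0) (stdBasis4.ne_zero 0)
      rw [tripleTensor_standard hr h] at h1
      simp only [if_true] at h1
      linarith
  · rw [if_pos, tripleTensor_standard hr h, abs_of_pos h0]
    intro w hw
    rw [hq]
    refine mul_pos h0 ?_
    obtain ⟨c, hc⟩ : ∃ c, stdBasis4.repr w c ≠ 0 := by
      by_contra! hc
      exact hw (by rw [← stdBasis4.sum_repr w]; simp [hc])
    exact Finset.sum_pos' (fun _ _ => sq_nonneg _) ⟨c, Finset.mem_univ _, by positivity⟩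

theorem energyDensity_standard (hr : r ≠ 0)
    (h : ∀ i a b, ω i ![stdBasis4 a, stdBasis4 b] = r * stdTriple i a b) (q : E4 → E4 → ℝ) :
    energyDensity ω q = |r| * ∑ a, q (stdBasis4 a) (stdBasis4 a) := by
  have hm : (Matrix.of fun a b => tripleMetric ω (stdBasis4 a) (stdBasis4 b)) =
      |r| • (1 : Matrix (Fin 4) (Fin 4) ℝ) := by
    ext a b
    refine (tripleMetric_standard hr h a b).trans ?_
    simp [Matrix.one_apply]
  have hinv : (|r| • (1 : Matrix (Fin 4) (Fin 4) ℝ))⁻¹ = |r|⁻¹ • 1 := by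
    apply Matrix.inv_eq_right_inv
    simp [hr]
  have hdet : √(Matrix.det (|r| • (1 : Matrix (Fin 4) (Fin 4) ℝ))) = |r| ^ 2 := by
    rw [Matrix.det_smul, Matrix.det_one, mul_one, Fintype.card_fin,
      show |r| ^ 4 = (|r| ^ 2) ^ 2 by ring, Real.sqrt_sq (by positivity)]
  have hr' : |r| ≠ 0 := abs_ne_zero.2 hr
  unfold energyDensity metricTrace
  rw [hm, hinv, hdet]
  rw [Matrix.smul_mul, one_mul, Matrix.trace_smul]
  simp only [smul_eq_mul, Matrix.trace, Matrix.diag_apply, Matrix.of_apply]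
  field_simp

/-- The pointwise inequality in the standard frame. There the left-hand side is `r` times a sum of
twelve products of pairs of coefficients of the `aᵢ`, in which every coefficient occurs twice, and
the right-hand side is `|r|` times the sum of the squares of the coefficients. The inequality is
`2 x y ≤ x² + y²` for each of the products. -/
theorem abs_topSum_le_standard (hr : r ≠ 0)
    (h : ∀ i a b, ω i ![stdBasis4 a, stdBasis4 b] = r * stdTriple i a b)
    (a : Fin 3 → E4 [⋀^Fin 1]→ₗ[ℝ] ℝ) : |topSum ω a| ≤ energyDensity ω (sumSq a) := by
  rw [energyDensity_standard hr h]
  set x : Fin 3 → Fin 4 → ℝ := fun i c => a i ![stdBasis4 c] with hx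
  have e : topSum ω a = r * (
      (x 1 2 * x 2 3 - x 1 3 * x 2 2 + x 1 0 * x 2 1 - x 1 1 * x 2 0)
      + (x 2 3 * x 0 1 - x 2 1 * x 0 3 + x 2 0 * x 0 2 - x 2 2 * x 0 0)
      + (x 0 1 * x 1 2 - x 0 2 * x 1 1 + x 0 0 * x 1 3 - x 0 3 * x 1 0)) := by
    unfold topSum
    have : ∀ i, (wedge (ω i) (wedge (a (i + 1)) (a (i + 2))) : E4 [⋀^Fin 4]→ₗ[ℝ] ℝ) stdBasis4 = _ :=
      fun i => wedge_two_two_apply (ω i) (wedge (a (i + 1)) (a (i + 2))) stdBasis4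
    simp only [this, h]
    have h2 : ∀ i j c d, wedge (a i) (a j) ![stdBasis4 c, stdBasis4 d] =
      x i c * x j d - x i d * x j c := fun i j c d => wedge_one_one_apply _ _ _
    rw [Fin.sum_univ_three]
    -- the wedge product has degree `1 + 1`, which agrees with `2` only after unfolding
    erw [h2, h2, h2, h2, h2, h2, h2, h2, h2, h2, h2, h2, h2, h2, h2, h2, h2, h2]
    simp [stdTriple]
    ring
  have e2 : ∑ c, sumSq a (stdBasis4 c) (stdBasis4 c) = ∑ c, ∑ i, x i c ^ 2 := by
    simp only [sumSq, hx, sq]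
  rw [e, e2, abs_mul]
  refine mul_le_mul_of_nonneg_left ?_ (abs_nonneg r)
  simp only [Fin.sum_univ_four, Fin.sum_univ_three]
  rw [abs_le]
  constructor
  · linarith [sq_nonneg (x 1 2 + x 2 3), sq_nonneg (x 1 3 - x 2 2), sq_nonneg (x 1 0 + x 2 1),
      sq_nonneg (x 1 1 - x 2 0), sq_nonneg (x 2 3 + x 0 1), sq_nonneg (x 2 1 - x 0 3), sq_nonneg
      (x 2 0 + x 0 2), sq_nonneg (x 2 2 - x 0 0), sq_nonneg (x 0 1 + x 1 2), sq_nonneg (x 0 2 -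
      x 1 1), sq_nonneg (x 0 0 + x 1 3), sq_nonneg (x 0 3 - x 1 0)]
  · linarith [sq_nonneg (x 1 2 - x 2 3), sq_nonneg (x 1 3 + x 2 2), sq_nonneg (x 1 0 - x 2 1),
      sq_nonneg (x 1 1 + x 2 0), sq_nonneg (x 2 3 - x 0 1), sq_nonneg (x 2 1 + x 0 3), sq_nonneg
      (x 2 0 - x 0 2), sq_nonneg (x 2 2 + x 0 0), sq_nonneg (x 0 1 - x 1 2), sq_nonneg (x 0 2 +
      x 1 1), sq_nonneg (x 0 0 - x 1 3), sq_nonneg (x 0 3 + x 1 0)]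

end Standard

/-- The pointwise inequality behind the energy bound. Under a linear change of coordinates `L` the
left-hand side is multiplied by `|det L|`, and so is the right-hand side, hence the inequality
follows from the one in an adapted frame. -/
theorem IsSU2Structure.abs_topSum_le {ω : Fin 3 → E4 [⋀^Fin 2]→ₗ[ℝ] ℝ} (h : IsSU2Structure ω)
    (a : Fin 3 → E4 [⋀^Fin 1]→ₗ[ℝ] ℝ) : |topSum ω a| ≤ energyDensity ω (sumSq a) := by
  obtain ⟨r, L, hr, hL, hω⟩ := h.exists_adapted_map
  have := abs_topSum_le_standard hr hω fun i => (a i).compLinearMap L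
  rw [topSum_compLinearMap, energyDensity_compLinearMap ω a hL, abs_mul] at this
  exact le_of_mul_le_mul_left this (abs_pos.2 hL)

theorem IsSU2Structure.det_tripleTensor_ne_zero {ω : Fin 3 → E4 [⋀^Fin 2]→ₗ[ℝ] ℝ}
    (h : IsSU2Structure ω) :
    (Matrix.of fun a b => tripleTensor ω (stdBasis4 a) (stdBasis4 b)).det ≠ 0 := by
  obtain ⟨r, L, hr, hL, hω⟩ := h.exists_adapted_map
  intro h0
  have h1 := bilin_comp_matrix (tripleBilin ω) L
  have h2 : (Matrix.of fun a b => tripleBilin ω (L (stdBasis4 a)) (L (stdBasis4 b))) =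
      r • (1 : Matrix (Fin 4) (Fin 4) ℝ) := by
    ext a b
    refine ((tripleTensor_compLinearMap ω hL _ _).symm.trans
      (tripleTensor_standard hr hω a b)).trans ?_
    simp [Matrix.one_apply]
  rw [h2] at h1
  have h3 := congrArg Matrix.det h1
  rw [Matrix.det_mul, Matrix.det_mul] at h3
  have h4 : (Matrix.of fun a b => tripleBilin ω (stdBasis4 a) (stdBasis4 b)).det = 0 := h0
  rw [h4] at h3
  simp [hr] at h3

/-- A formula for the energy density that does not involve the sign in the definition of the
metric, and so is visibly continuous. -/
theorem IsSU2Structure.energyDensity_eq {ω : Fin 3 → E4 [⋀^Fin 2]→ₗ[ℝ] ℝ} (h : IsSU2Structure ω)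
    (a : Fin 3 → E4 [⋀^Fin 1]→ₗ[ℝ] ℝ) :
    energyDensity ω (sumSq a) = |metricTrace (tripleTensor ω) (sumSq a) *
      √(Matrix.det (Matrix.of fun a b => tripleTensor ω (stdBasis4 a) (stdBasis4 b)))| := by
  rw [← abs_of_nonneg ((abs_nonneg _).trans (h.abs_topSum_le a))]
  unfold energyDensity
  by_cases hpos : ∀ w : E4, w ≠ 0 → 0 < tripleTensor ω w w
  · have : tripleMetric ω = tripleTensor ω := by
      funext u v; unfold tripleMetric; rw [if_pos hpos]
    rw [this]
  · have : tripleMetric ω = fun u v => -tripleTensor ω u v := by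
      funext u v; unfold tripleMetric; rw [if_neg hpos]
    rw [this]
    set G := Matrix.of fun a b => tripleTensor ω (stdBasis4 a) (stdBasis4 b) with hG
    have e : (Matrix.of fun a b => -tripleTensor ω (stdBasis4 a) (stdBasis4 b)) = -G := rfl
    have hd : IsUnit G.det := h.det_tripleTensor_ne_zero.isUnit
    have hinv : (-G)⁻¹ = -G⁻¹ := Matrix.inv_eq_right_inv (by
      rw [neg_mul_neg, Matrix.mul_nonsing_inv _ hd])
    unfold metricTrace
    rw [e, Matrix.det_neg, hinv, neg_mul, Matrix.trace_neg, ← hG]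
    have h4 : (-1 : ℝ) ^ Fintype.card (Fin 4) = 1 := by norm_num
    rw [h4, one_mul, neg_mul, abs_neg]

end

/-! ### Lifts of maps to the quotient of the torus -/

section

open Filter

theorem torusMk_eq_iff (a b : E3) :
    torusMk a = torusMk b ↔ ∃ n : Fin 3 → ℤ, ∀ i, a i - b i = n i := by
  constructor
  · intro h
    have : ∀ i, ∃ n : ℤ, a i - b i = n := fun i => by
      have h1 : (a i : UnitAddCircle) = (b i : UnitAddCircle) := congrFun h i
      rw [← sub_eq_zero, ← AddCircle.coe_sub, AddCircle.coe_eq_zero_iff] at h1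
      obtain ⟨n, hn⟩ := h1
      exact ⟨n, by simpa using hn.symm⟩
    choose n hn using this
    exact ⟨n, hn⟩
  · rintro ⟨n, hn⟩
    funext i
    show (a i : UnitAddCircle) = (b i : UnitAddCircle)
    rw [← sub_eq_zero, ← AddCircle.coe_sub, AddCircle.coe_eq_zero_iff]
    exact ⟨n i, by simp [hn]⟩

theorem orbProj_eq_iff (a b : E3) : orbProj a = orbProj b ↔
    ∃ σ : ℤˣ, torusMk a = torusMk ((σ : ℤ) • b) := by
  have : orbProj a = orbProj b ↔ torusMk a ∈ MulAction.orbit ℤˣ (torusMk b) := by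
    unfold orbProj
    rw [Quotient.eq'', MulAction.orbitRel_apply]
  rw [this, MulAction.mem_orbit_iff]
  refine exists_congr fun σ => ?_
  have h : σ • torusMk b = torusMk ((σ : ℤ) • b) := by
    funext i
    rcases Int.units_eq_one_or σ with rfl | rfl <;> simp [torusMk]
  rw [h, eq_comm]

/-- Discreteness of `ℤ³`: values of a convergent function that lie in the lattice are eventually
equal to the limit, provided that the limit lies in the lattice. -/
theorem eventually_eq_of_tendsto_of_int {ι : Type*} {l : Filter ι} {f : ι → E3} {a : E3}
    (h : Tendsto f l (𝓝 a)) :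
    ∀ᶠ t in l, torusMk (f t) = torusMk 0 → torusMk a = torusMk 0 → f t = a := by
  have h1 : ∀ᶠ t in l, dist (f t) a < 1 := h.eventually (Metric.ball_mem_nhds a one_pos)
  filter_upwards [h1] with t ht h2 h3
  rw [torusMk_eq_iff] at h2 h3
  obtain ⟨n, hn⟩ := h2
  obtain ⟨m, hm⟩ := h3
  ext i
  have h4 : |f t i - a i| < 1 := by
    refine lt_of_le_of_lt ?_ ht
    rw [dist_eq_norm]
    exact (PiLp.norm_apply_le (f t - a) i)
  have h5 := hn i; have h6 := hm i
  simp only [PiLp.zero_apply, sub_zero] at h5 h6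
  rw [h5, h6] at h4 ⊢
  have h7 : ((|n i - m i| : ℤ) : ℝ) < 1 := by push_cast; exact h4
  have : |n i - m i| < 1 := by exact_mod_cast h7
  have := Int.abs_lt_one_iff.1 this
  have : n i = m i := by omega
  rw [this]

theorem isClosed_torusMk_eq_zero : IsClosed {a : E3 | torusMk a = torusMk 0} := by
  have h : Continuous torusMk := by
    unfold torusMk
    refine continuous_pi fun i => ?_
    exact (AddCircle.continuous_mk' 1).comp (by fun_prop)
  exact isClosed_singleton.preimage h

section Lift

variable {W : Type*} [NormedAddCommGroup W] [NormedSpace ℝ W]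

/-- `G` is a `C²` lift to `ℝ³` of the map `Φ` into `T/{±1}` near `p`. Two derivatives are what the
closedness of pullbacks requires. -/
def IsLiftAt (Φ : W → TorusQuot) (p : W) (G : W → E3) : Prop :=
  ContDiffAt ℝ 2 G p ∧ ∀ᶠ q in 𝓝 p, orbProj (G q) = Φ q

theorem IsLiftAt.eventually {Φ : W → TorusQuot} {p : W} {G : W → E3} (h : IsLiftAt Φ p G) :
    ∀ᶠ q in 𝓝 p, IsLiftAt Φ q G :=
  (h.1.eventually (by decide)).and h.2.eventually_nhds

theorem IsLiftAt.differentiableAt {Φ : W → TorusQuot} {p : W} {G : W → E3}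
    (h : IsLiftAt Φ p G) : DifferentiableAt ℝ G p := h.1.differentiableAt (by decide)

/-- Near a fixed point of `-1` two lifts may be related by different signs on different sides of
`p`. In each direction `v` one of the signs occurs arbitrarily close to `p`, and then it relates
the derivatives in the direction `v`. -/
theorem IsLiftAt.exists_sign_direction {Φ : W → TorusQuot} {p : W} {G G' : W → E3}
    (h : IsLiftAt Φ p G) (h' : IsLiftAt Φ p G') (v : W) :
    ∃ σ : ℤˣ, torusMk (G' p) = torusMk ((σ : ℤ) • G p) ∧
      fderiv ℝ G' p v = (σ : ℤ) • fderiv ℝ G p v := by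
  have hline : Tendsto (fun t : ℝ => p + t • v) (𝓝[≠] 0) (𝓝 p) := by
    have : Tendsto (fun t : ℝ => p + t • v) (𝓝 0) (𝓝 (p + (0 : ℝ) • v)) :=
      (by fun_prop : Continuous fun t : ℝ => p + t • v).tendsto 0
    rw [zero_smul, add_zero] at this
    exact this.mono_left nhdsWithin_le_nhds
  have h1 : ∀ᶠ t : ℝ in 𝓝[≠] 0, ∃ σ : ℤˣ,
      torusMk (G' (p + t • v)) = torusMk ((σ : ℤ) • G (p + t • v)) := by
    filter_upwards [hline.eventually h.2, hline.eventually h'.2] with t ht ht'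
    exact (orbProj_eq_iff _ _).1 (ht'.trans ht.symm)
  have h2 : ∃ σ : ℤˣ, ∃ᶠ t : ℝ in 𝓝[≠] 0,
      torusMk (G' (p + t • v)) = torusMk ((σ : ℤ) • G (p + t • v)) := by
    by_contra! hc
    have h3 := (hc 1).and (hc (-1))
    obtain ⟨t, ⟨σ, hσ⟩, h4, h5⟩ := (h1.and h3).exists
    rcases Int.units_eq_one_or σ with rfl | rfl
    · exact h4 hσ
    · exact h5 hσ
  obtain ⟨σ, hσ⟩ := h2
  refine ⟨σ, ?_⟩
  set D : W → E3 := fun q => G' q - (σ : ℤ) • G q with hD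
  have hDiff : HasFDerivAt D (fderiv ℝ G' p - (σ : ℤ) • fderiv ℝ G p) p :=
    h'.differentiableAt.hasFDerivAt.sub (h.differentiableAt.hasFDerivAt.const_smul (σ : ℤ))
  have hmk : ∀ q, torusMk (G' q) = torusMk ((σ : ℤ) • G q) ↔ torusMk (D q) = torusMk 0 := by
    intro q
    rw [torusMk_eq_iff, torusMk_eq_iff]
    simp [hD]
  simp only [hmk] at hσ ⊢
  have hcont : Tendsto (fun t : ℝ => D (p + t • v)) (𝓝[≠] 0) (𝓝 (D p)) :=
    hDiff.continuousAt.tendsto.comp hline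
  have hp : torusMk (D p) = torusMk 0 :=
    isClosed_torusMk_eq_zero.mem_of_frequently_of_tendsto hσ hcont
  refine ⟨hp, ?_⟩
  have hfreq : ∃ᶠ t : ℝ in 𝓝[≠] 0, D (p + t • v) = D p :=
    (hσ.and_eventually (eventually_eq_of_tendsto_of_int hcont)).mono fun t ht => ht.2 ht.1 hp
  have hder : HasDerivAt (fun t : ℝ => D (p + t • v))
      ((fderiv ℝ G' p - (σ : ℤ) • fderiv ℝ G p) v) 0 := by
    have hl : HasDerivAt (fun t : ℝ => p + t • v) v 0 := by
      simpa using ((hasDerivAt_id (0 : ℝ)).smul_const v).const_add p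
    have hDiff' : HasFDerivAt D (fderiv ℝ G' p - (σ : ℤ) • fderiv ℝ G p) (p + (0 : ℝ) • v) := by
      simpa using hDiff
    exact hDiff'.comp_hasDerivAt 0 hl
  have hzero : (fderiv ℝ G' p - (σ : ℤ) • fderiv ℝ G p) v = 0 := by
    by_contra hne
    have := hder.eventually_ne (c := D p) hne
    obtain ⟨t, h3, h4⟩ := (hfreq.and_eventually this).exists
    exact h4 h3
  rw [_root_.sub_apply, sub_eq_zero] at hzero
  exact hzero

/-- Two lifts of the same map are related by an element of `ℤ³ ⋊ {±1}` to first order. The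
derivatives agree up to sign because a vector space is not the union of two proper subspaces. -/
theorem IsLiftAt.exists_sign {Φ : W → TorusQuot} {p : W} {G G' : W → E3}
    (h : IsLiftAt Φ p G) (h' : IsLiftAt Φ p G') :
    ∃ σ : ℤˣ, torusMk (G' p) = torusMk ((σ : ℤ) • G p) ∧
      ∀ v, fderiv ℝ G' p v = (σ : ℤ) • fderiv ℝ G p v := by
  by_contra! hc
  have hdir := h.exists_sign_direction h'
  obtain ⟨σ₀, hσ₀, -⟩ := hdir 0
  by_cases h1 : torusMk (G' p) = torusMk (((1 : ℤˣ) : ℤ) • G p)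
  · by_cases h2 : torusMk (G' p) = torusMk (((-1 : ℤˣ) : ℤ) • G p)
    · obtain ⟨v, hv⟩ := hc 1 h1
      obtain ⟨w, hw⟩ := hc (-1) h2
      have key : ∀ u, fderiv ℝ G' p u = fderiv ℝ G p u ∨ fderiv ℝ G' p u = -fderiv ℝ G p u := by
        intro u
        obtain ⟨σ, -, hu⟩ := hdir u
        rcases Int.units_eq_one_or σ with rfl | rfl
        · left; simpa using hu
        · right; simpa using hu
      have hv' : fderiv ℝ G' p v ≠ fderiv ℝ G p v := by simpa using hv
      have hw' : fderiv ℝ G' p w ≠ -fderiv ℝ G p w := by simpa using hw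
      have e1 := (key v).resolve_left hv'
      have e2 := (key w).resolve_right hw'
      rcases key (v + w) with h3 | h3
      · rw [map_add, map_add, e2] at h3
        exact hv' (add_right_cancel h3)
      · rw [map_add, map_add, e1, neg_add] at h3
        exact hw' (add_left_cancel h3)
    · obtain ⟨v, hv⟩ := hc 1 h1
      obtain ⟨σ, hσ, hu⟩ := hdir v
      rcases Int.units_eq_one_or σ with rfl | rfl
      · exact hv hu
      · exact h2 hσ
  · obtain ⟨v, hv⟩ := hc σ₀ hσ₀
    obtain ⟨σ, hσ, hu⟩ := hdir v
    rcases Int.units_eq_one_or σ with rfl | rfl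
    · exact h1 hσ
    · rcases Int.units_eq_one_or σ₀ with rfl | rfl
      · exact h1 hσ₀
      · exact hv hu

end Lift

end

/-! ### Pullback of forms along lifts -/

section

open Filter

/-- The form `θᵢ` at `x` as a linear functional. -/
def TorusCoframe.functional (θ : TorusCoframe) (i : Fin 3) (x : E3) : E3 →L[ℝ] ℝ :=
  (ContinuousAlternatingMap.ofSubsingleton ℝ E3 ℝ (0 : Fin 1)).symm (θ.form i x)

theorem TorusCoframe.functional_apply (θ : TorusCoframe) (i : Fin 3) (x v : E3) :
    θ.functional i x v = θ.form i x ![v] := by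
  have : (fun _ : Fin 1 => v) = ![v] := by ext i; fin_cases i; rfl
  rw [← this]; rfl

theorem TorusCoframe.contDiff_functional (θ : TorusCoframe) (i : Fin 3) :
    ContDiff ℝ ∞ (θ.functional i) := by
  rw [contDiff_clm_apply_iff]
  intro v
  simp only [θ.functional_apply]
  exact (ContinuousAlternatingMap.apply ℝ E3 ℝ ![v]).contDiff.comp (θ.smooth i)

theorem TorusCoframe.differentiable_functional (θ : TorusCoframe) (i : Fin 3) :
    Differentiable ℝ (θ.functional i) := (θ.contDiff_functional i).differentiable (by decide)

/-- The closedness of `θᵢ`, as symmetry of its derivative. -/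
theorem TorusCoframe.fderiv_functional_symm (θ : TorusCoframe) (i : Fin 3) (x u v : E3) :
    fderiv ℝ (θ.functional i) x u v = fderiv ℝ (θ.functional i) x v u := by
  have h := extDeriv_apply (((θ.smooth i).differentiable (by decide)) x) ![u, v]
  rw [θ.closed] at h
  have e0 : (0 : Fin 2).removeNth ![u, v] = ![v] := by ext j; fin_cases j; rfl
  have e1 : (1 : Fin 2).removeNth ![u, v] = ![u] := by ext j; fin_cases j; rfl
  have hd : ∀ a b, fderiv ℝ (fun y => θ.form i y ![a]) x b = fderiv ℝ (θ.functional i) x b a := by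
    intro a b
    simp only [← θ.functional_apply]
    rw [fderiv_clm_apply (θ.differentiable_functional i x) (differentiableAt_const a)]
    simp
  rw [Fin.sum_univ_two, e0, e1, hd, hd] at h
  simp at h
  linarith

/-- Invariance of `θᵢ` under `ℤ³` and its oddness under `-1`, combined. -/
theorem TorusCoframe.form_sign (θ : TorusCoframe) (i : Fin 3) {x x' : E3} {σ : ℤˣ}
    (h : torusMk x' = torusMk ((σ : ℤ) • x)) (v : E3) :
    θ.form i x' ![(σ : ℤ) • v] = (σ : ℤ) • θ.form i x ![v] := by
  rw [θ.periodic i _ _ h]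
  rcases Int.units_eq_one_or σ with rfl | rfl
  · simp
  · have h1 := congrArg (fun f => f ![v]) (θ.odd i x)
    simp only [ContinuousAlternatingMap.compContinuousLinearMap_apply] at h1
    have h2 : (⇑(-ContinuousLinearMap.id ℝ E3) ∘ ![v]) = ![-v] := by
      ext j; fin_cases j; rfl
    rw [h2] at h1
    simpa using h1

section Pull

variable {W : Type*} [NormedAddCommGroup W] [NormedSpace ℝ W]

/-- The pullback `G^*θᵢ` at `p`. -/
def TorusCoframe.pull (θ : TorusCoframe) (G : W → E3) (p : W) (i : Fin 3) : W [⋀^Fin 1]→ₗ[ℝ] ℝ :=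
  (θ.form i (G p)).toAlternatingMap.compLinearMap (fderiv ℝ G p).toLinearMap

theorem TorusCoframe.pull_apply (θ : TorusCoframe) (G : W → E3) (p : W) (i : Fin 3) (v : W) :
    θ.pull G p i ![v] = θ.functional i (G p) (fderiv ℝ G p v) := by
  rw [TorusCoframe.pull, compLinearMap_one_apply, θ.functional_apply]; rfl

theorem alternating_one_ext {V : Type*} [AddCommGroup V] [Module ℝ V] {α β : V [⋀^Fin 1]→ₗ[ℝ] ℝ}
    (h : ∀ v, α ![v] = β ![v]) : α = β := by
  ext v
  rw [alternating_one_eta α, alternating_one_eta β, h]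

/-- The pullbacks of `θ₁, θ₂, θ₃` by two lifts agree up to a common sign, which drops out of all
quadratic expressions. -/
theorem TorusCoframe.pull_sign (θ : TorusCoframe) {Φ : W → TorusQuot} {p : W} {G G' : W → E3}
    (h : IsLiftAt Φ p G) (h' : IsLiftAt Φ p G') :
    ∃ σ : ℤˣ, ∀ i, θ.pull G' p i = ((σ : ℤ) : ℝ) • θ.pull G p i := by
  obtain ⟨σ, h1, h2⟩ := h.exists_sign h'
  refine ⟨σ, fun i => alternating_one_ext fun v => ?_⟩
  rw [AlternatingMap.smul_apply, θ.pull_apply, θ.pull_apply, h2, θ.functional_apply,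
    θ.functional_apply, θ.form_sign i h1]
  simp

theorem units_cast_mul_self (σ : ℤˣ) : ((σ : ℤ) : ℝ) * ((σ : ℤ) : ℝ) = 1 := by
  rcases Int.units_eq_one_or σ with rfl | rfl <;> simp

theorem TorusCoframe.wedge_pull_eq (θ : TorusCoframe) {Φ : W → TorusQuot} {p : W} {G G' : W → E3}
    (h : IsLiftAt Φ p G) (h' : IsLiftAt Φ p G') (i j : Fin 3) :
    wedge (θ.pull G' p i) (θ.pull G' p j) = wedge (θ.pull G p i) (θ.pull G p j) := by
  obtain ⟨σ, hσ⟩ := θ.pull_sign h h'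
  ext v
  rw [wedge_one_one_apply, wedge_one_one_apply, hσ, hσ]
  simp only [AlternatingMap.smul_apply, smul_eq_mul]
  linear_combination (θ.pull G p i ![v 0] * θ.pull G p j ![v 1] -
    θ.pull G p i ![v 1] * θ.pull G p j ![v 0]) * units_cast_mul_self σ

theorem TorusCoframe.sumSq_pull_eq (θ : TorusCoframe) {Φ : W → TorusQuot} {p : W} {G G' : W → E3}
    (h : IsLiftAt Φ p G) (h' : IsLiftAt Φ p G') :
    sumSq (θ.pull G' p) = sumSq (θ.pull G p) := by
  obtain ⟨σ, hσ⟩ := θ.pull_sign h h'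
  funext u v
  unfold sumSq
  refine Finset.sum_congr rfl fun i _ => ?_
  rw [hσ]
  simp only [AlternatingMap.smul_apply, smul_eq_mul]
  linear_combination (θ.pull G p i ![u] * θ.pull G p i ![v]) * units_cast_mul_self σ

theorem TorusCoframe.contDiffAt_pull (θ : TorusCoframe) {p : W} {G : W → E3}
    (hG : ContDiffAt ℝ 2 G p) (i : Fin 3) (v : W) :
    ContDiffAt ℝ 1 (fun q => θ.pull G q i ![v]) p := by
  simp only [θ.pull_apply]
  have h1 : ContDiffAt ℝ 1 (fun q => θ.functional i (G q)) p :=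
    ((θ.contDiff_functional i).contDiffAt.of_le (by decide)).comp p (hG.of_le (by decide))
  have h2 : ContDiffAt ℝ 1 (fderiv ℝ G) p := hG.fderiv_right (by norm_num)
  exact h1.clm_apply (h2.clm_apply contDiffAt_const)

/-- The closedness of `G^*θᵢ`. -/
theorem TorusCoframe.fderiv_pull_symm (θ : TorusCoframe) {p : W} {G : W → E3}
    (hG : ContDiffAt ℝ 2 G p) (i : Fin 3) (u v : W) :
    fderiv ℝ (fun q => θ.pull G q i ![v]) p u = fderiv ℝ (fun q => θ.pull G q i ![u]) p v := by
  have hG1 : DifferentiableAt ℝ G p := hG.differentiableAt (by decide)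
  have h2 : DifferentiableAt ℝ (fderiv ℝ G) p :=
    (hG.fderiv_right (m := 1) (by norm_num)).differentiableAt (by decide)
  have hT := θ.differentiable_functional i (G p)
  have key : ∀ a b, fderiv ℝ (fun q => θ.pull G q i ![a]) p b =
      θ.functional i (G p) (fderiv ℝ (fderiv ℝ G) p b a) +
      fderiv ℝ (θ.functional i) (G p) (fderiv ℝ G p b) (fderiv ℝ G p a) := by
    intro a b
    simp only [θ.pull_apply]
    have e1 : DifferentiableAt ℝ (fun q => θ.functional i (G q)) p := hT.comp p hG1
    have e2 : DifferentiableAt ℝ (fun q => fderiv ℝ G q a) p :=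
      h2.clm_apply (differentiableAt_const a)
    rw [fderiv_clm_apply e1 e2, fderiv_clm_apply h2 (differentiableAt_const a)]
    have e3 : fderiv ℝ (fun q => θ.functional i (G q)) p =
        (fderiv ℝ (θ.functional i) (G p)).comp (fderiv ℝ G p) := fderiv_comp p hT hG1
    rw [e3]
    simp
  rw [key, key, θ.fderiv_functional_symm i, (hG.isSymmSndFDerivAt (by simp)).eq]

open Classical in
/-- A lift of `Φ` near `p`, if there is one, and zero otherwise. -/
def chosenLift (Φ : W → TorusQuot) (p : W) : W → E3 :=
  if h : ∃ G, IsLiftAt Φ p G then h.choose else 0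

theorem IsLiftAt.chosenLift {Φ : W → TorusQuot} {p : W} {G : W → E3} (h : IsLiftAt Φ p G) :
    IsLiftAt Φ p (chosenLift Φ p) := by
  have h' : ∃ G, IsLiftAt Φ p G := ⟨G, h⟩
  unfold _root_.chosenLift
  rw [dif_pos h']
  exact h'.choose_spec

/-- The 2-form `Φ^*Θⱼ` of a map `Φ` into `T/{±1}`, at the point `p`. It is computed in a chosen lift
and, by `IsLiftAt.orbTwoForm_eq`, does not depend on the choice. -/
def TorusCoframe.orbTwoForm (θ : TorusCoframe) (j : Fin 3) (Φ : W → TorusQuot) (p : W) :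
    W [⋀^Fin 2]→ₗ[ℝ] ℝ :=
  wedge (θ.pull (chosenLift Φ p) p (j + 1)) (θ.pull (chosenLift Φ p) p (j + 2))

/-- The symmetric bilinear form `Φ^*g_θ` of a map `Φ` into `T/{±1}`, at the point `p`. It is
computed in a chosen lift and, by `IsLiftAt.orbMetric_eq`, does not depend on the choice. -/
def TorusCoframe.orbMetric (θ : TorusCoframe) (Φ : W → TorusQuot) (p : W) : W → W → ℝ :=
  sumSq (θ.pull (chosenLift Φ p) p)

variable {Φ : W → TorusQuot} {p : W} {G : W → E3} (θ : TorusCoframe) (j : Fin 3)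

theorem IsLiftAt.orbTwoForm_eq (h : IsLiftAt Φ p G) :
    θ.orbTwoForm j Φ p = wedge (θ.pull G p (j + 1)) (θ.pull G p (j + 2)) :=
  θ.wedge_pull_eq h h.chosenLift _ _

theorem IsLiftAt.orbTwoForm_apply (h : IsLiftAt Φ p G) (u v : W) :
    θ.orbTwoForm j Φ p ![u, v] = θ.pull G p (j + 1) ![u] * θ.pull G p (j + 2) ![v] -
      θ.pull G p (j + 1) ![v] * θ.pull G p (j + 2) ![u] := by
  rw [h.orbTwoForm_eq θ j]
  exact wedge_one_one_apply _ _ _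

theorem IsLiftAt.orbMetric_eq (h : IsLiftAt Φ p G) : θ.orbMetric Φ p = sumSq (θ.pull G p) :=
  θ.sumSq_pull_eq h h.chosenLift

theorem IsLiftAt.orbTwoForm_eventuallyEq (h : IsLiftAt Φ p G) (u v : W) :
    (fun q => θ.orbTwoForm j Φ q ![u, v]) =ᶠ[𝓝 p] fun q =>
      θ.pull G q (j + 1) ![u] * θ.pull G q (j + 2) ![v] -
      θ.pull G q (j + 1) ![v] * θ.pull G q (j + 2) ![u] :=
  h.eventually.mono fun _ hq => hq.orbTwoForm_apply θ j u v

theorem IsLiftAt.contDiffAt_orbTwoForm (h : IsLiftAt Φ p G) (u v : W) :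
    ContDiffAt ℝ 1 (fun q => θ.orbTwoForm j Φ q ![u, v]) p := by
  refine ContDiffAt.congr_of_eventuallyEq ?_ (h.orbTwoForm_eventuallyEq θ j u v)
  exact ((θ.contDiffAt_pull h.1 _ u).mul (θ.contDiffAt_pull h.1 _ v)).sub
    ((θ.contDiffAt_pull h.1 _ v).mul (θ.contDiffAt_pull h.1 _ u))

theorem IsLiftAt.continuousAt_orbMetric (h : IsLiftAt Φ p G) (u v : W) :
    ContinuousAt (fun q => θ.orbMetric Φ q u v) p := by
  have : (fun q => θ.orbMetric Φ q u v) =ᶠ[𝓝 p] fun q => sumSq (θ.pull G q) u v :=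
    h.eventually.mono fun q hq => by
      simp only [hq.orbMetric_eq θ]
  refine ContinuousAt.congr ?_ this.symm
  unfold sumSq
  exact tendsto_finsetSum _ fun i _ =>
    ((θ.contDiffAt_pull h.1 i u).continuousAt.mul (θ.contDiffAt_pull h.1 i v).continuousAt)

/-- The 2-form `Φ^*Θⱼ` is closed. -/
theorem IsLiftAt.fderiv_orbTwoForm_cyclic (h : IsLiftAt Φ p G) (a b c : W) :
    fderiv ℝ (fun q => θ.orbTwoForm j Φ q ![b, c]) p a +
      fderiv ℝ (fun q => θ.orbTwoForm j Φ q ![c, a]) p b +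
      fderiv ℝ (fun q => θ.orbTwoForm j Φ q ![a, b]) p c = 0 := by
  have hd : ∀ i v, DifferentiableAt ℝ (fun q => θ.pull G q i ![v]) p := fun i v =>
    (θ.contDiffAt_pull h.1 i v).differentiableAt (by decide)
  have key : ∀ u v w, fderiv ℝ (fun q => θ.orbTwoForm j Φ q ![u, v]) p w =
      (θ.pull G p (j + 1) ![u] * fderiv ℝ (fun q => θ.pull G q (j + 2) ![v]) p w +
        θ.pull G p (j + 2) ![v] * fderiv ℝ (fun q => θ.pull G q (j + 1) ![u]) p w) -
      (θ.pull G p (j + 1) ![v] * fderiv ℝ (fun q => θ.pull G q (j + 2) ![u]) p w +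
        θ.pull G p (j + 2) ![u] * fderiv ℝ (fun q => θ.pull G q (j + 1) ![v]) p w) := by
    intro u v w
    rw [(h.orbTwoForm_eventuallyEq θ j u v).fderiv_eq,
      fderiv_fun_sub ((hd _ _).fun_mul (hd _ _)) ((hd _ _).fun_mul (hd _ _)),
      fderiv_fun_mul (hd _ _) (hd _ _), fderiv_fun_mul (hd _ _) (hd _ _)]
    simp
  have hs := fun i u v => θ.fderiv_pull_symm h.1 i u v
  rw [key, key, key, hs (j + 1) b a, hs (j + 1) c a, hs (j + 1) c b, hs (j + 2) b a,
    hs (j + 2) c a, hs (j + 2) c b]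
  ring

variable {W' : Type*} [NormedAddCommGroup W'] [NormedSpace ℝ W']

theorem IsLiftAt.comp {τ : W' → W} {p' : W'} (h : IsLiftAt Φ (τ p') G)
    (hτ : ContDiffAt ℝ 2 τ p') : IsLiftAt (Φ ∘ τ) p' (G ∘ τ) :=
  ⟨h.1.comp p' hτ, hτ.continuousAt.eventually h.2⟩

theorem IsLiftAt.congr {Φ' : W → TorusQuot} (h : IsLiftAt Φ p G) (h' : Φ' =ᶠ[𝓝 p] Φ) :
    IsLiftAt Φ' p G :=
  ⟨h.1, by filter_upwards [h.2, h'] with q h1 h2; rw [h1, h2]⟩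

theorem IsLiftAt.pull_comp {τ : W' → W} {p' : W'} (h : IsLiftAt Φ (τ p') G)
    (hτ : ContDiffAt ℝ 2 τ p') (i : Fin 3) :
    θ.pull (G ∘ τ) p' i = (θ.pull G (τ p') i).compLinearMap (fderiv ℝ τ p').toLinearMap := by
  refine alternating_one_ext fun v => ?_
  rw [compLinearMap_one_apply, θ.pull_apply, θ.pull_apply,
    fderiv_comp p' h.differentiableAt (hτ.differentiableAt (by decide))]
  rfl

/-- Naturality of `Φ^*Θⱼ` under smooth maps. -/
theorem IsLiftAt.orbTwoForm_comp {τ : W' → W} {p' : W'} {Φ' : W' → TorusQuot}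
    (h : IsLiftAt Φ (τ p') G) (hτ : ContDiffAt ℝ 2 τ p') (h' : Φ' =ᶠ[𝓝 p'] Φ ∘ τ) :
    θ.orbTwoForm j Φ' p' =
      (θ.orbTwoForm j Φ (τ p')).compLinearMap (fderiv ℝ τ p').toLinearMap := by
  rw [((h.comp hτ).congr h').orbTwoForm_eq θ j, h.orbTwoForm_eq θ j,
    wedge_compLinearMap_one_one, h.pull_comp θ hτ, h.pull_comp θ hτ]

end Pull

end

/-! ### Coordinate changes and integrals in charts -/

section

open Filter MeasureTheory Set

section Charts

variable {X : Type*} [TopologicalSpace X] [ChartedSpace E4 X]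

/-- The coordinate change from the chart around `c` to the chart around `m`. -/
def chartTransition (c m : X) : E4 → E4 := extChartAt (𝓡 4) m ∘ (extChartAt (𝓡 4) c).symm

/-- The part of the chart around `c` that is covered by the chart around `m`. -/
def chartOverlap (c m : X) : Set E4 :=
  (extChartAt (𝓡 4) c).target ∩ (extChartAt (𝓡 4) c).symm ⁻¹' (extChartAt (𝓡 4) m).source

theorem isOpen_chartOverlap (c m : X) : IsOpen (chartOverlap c m) :=
  (continuousOn_extChartAt_symm c).isOpen_inter_preimage (isOpen_extChartAt_target c)
    (isOpen_extChartAt_source m)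

theorem chartTransition_mem {c m : X} {y : E4} (hy : y ∈ chartOverlap c m) :
    chartTransition c m y ∈ chartOverlap m c := by
  refine ⟨(extChartAt (𝓡 4) m).map_source hy.2, ?_⟩
  simp only [mem_preimage, chartTransition, Function.comp_apply,
    (extChartAt (𝓡 4) m).left_inv hy.2]
  exact (extChartAt (𝓡 4) c).map_target hy.1

theorem symm_chartTransition {c m : X} {y : E4} (hy : y ∈ chartOverlap c m) :
    (extChartAt (𝓡 4) m).symm (chartTransition c m y) = (extChartAt (𝓡 4) c).symm y :=
  (extChartAt (𝓡 4) m).left_inv hy.2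

theorem chartTransition_chartTransition {c m : X} {y : E4} (hy : y ∈ chartOverlap c m) :
    chartTransition m c (chartTransition c m y) = y := by
  rw [chartTransition, Function.comp_apply, symm_chartTransition hy,
    (extChartAt (𝓡 4) c).right_inv hy.1]

theorem image_chartTransition (c m : X) :
    chartTransition c m '' chartOverlap c m = chartOverlap m c := by
  refine Subset.antisymm ?_ fun y hy => ⟨chartTransition m c y, chartTransition_mem hy,
    chartTransition_chartTransition hy⟩
  rintro _ ⟨y, hy, rfl⟩
  exact chartTransition_mem hy

theorem symm_eventuallyEq {c m : X} {y : E4} (hy : y ∈ chartOverlap c m) :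
    (extChartAt (𝓡 4) c).symm =ᶠ[𝓝 y] (extChartAt (𝓡 4) m).symm ∘ chartTransition c m :=
  Filter.eventually_of_mem ((isOpen_chartOverlap c m).mem_nhds hy) fun _ hz =>
    (symm_chartTransition hz).symm

/-- The derivative of the inverse chart as an endomorphism of `ℝ⁴`, the space on which the tangent
spaces are modelled. -/
def chartSymmDerivEnd (c : X) (y : E4) : E4 →L[ℝ] E4 := chartSymmDeriv c y

/-- A form on `X` in the chart around `c`, as an algebraic alternating map. -/
def algFormInChart {k : ℕ} (ω : (x : X) → (TangentSpace (𝓡 4) x) [⋀^Fin k]→L[ℝ] ℝ) (c : X)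
    (y : E4) : E4 [⋀^Fin k]→ₗ[ℝ] ℝ :=
  (formInChart ω c y).toAlternatingMap

/-- A form at a point of `X`, as an algebraic alternating map on `ℝ⁴`, the space on which the
tangent spaces are modelled. -/
def algFormAt {k : ℕ} (ω : (x : X) → (TangentSpace (𝓡 4) x) [⋀^Fin k]→L[ℝ] ℝ) (x : X) :
    E4 [⋀^Fin k]→ₗ[ℝ] ℝ :=
  (ω x).toAlternatingMap

theorem algFormInChart_eq {k : ℕ} (ω : (x : X) → (TangentSpace (𝓡 4) x) [⋀^Fin k]→L[ℝ] ℝ) (c : X)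
    (y : E4) : algFormInChart ω c y =
      (algFormAt ω ((extChartAt (𝓡 4) c).symm y)).compLinearMap
        (chartSymmDerivEnd c y : E4 →ₗ[ℝ] E4) := rfl

variable [IsManifold (𝓡 4) ∞ X]

theorem contDiffAt_chartTransition {c m : X} {y : E4} (hy : y ∈ chartOverlap c m) :
    ContDiffAt ℝ ∞ (chartTransition c m) y := by
  have h := contDiffWithinAt_ext_coord_change (I := 𝓡 4) (n := ∞) m c (y := y) ⟨hy.1, hy.2⟩
  rwa [ModelWithCorners.range_eq_univ, contDiffWithinAt_univ] at h

theorem differentiableAt_chartTransition {c m : X} {y : E4} (hy : y ∈ chartOverlap c m) :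
    DifferentiableAt ℝ (chartTransition c m) y :=
  (contDiffAt_chartTransition hy).differentiableAt (by decide)

theorem det_fderiv_chartTransition_pos (hX : IsOrientedAtlas X) {c m : X} {y : E4}
    (hy : y ∈ chartOverlap c m) : 0 < (fderiv ℝ (chartTransition c m) y).det := by
  have h := hX c m ((extChartAt (𝓡 4) c).symm y)
    (by simpa using (extChartAt (𝓡 4) c).map_target hy.1) (by simpa using hy.2)
  simp only [tangentCoordChange_def, ModelWithCorners.range_eq_univ, fderivWithin_univ] at h
  rwa [(extChartAt (𝓡 4) c).right_inv hy.1] at h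

theorem contMDiffAt_extChartAt_symm {c : X} {y : E4} (hy : y ∈ (extChartAt (𝓡 4) c).target) :
    ContMDiffAt 𝓘(ℝ, E4) (𝓡 4) ∞ (extChartAt (𝓡 4) c).symm y :=
  (contMDiffOn_extChartAt_symm c).contMDiffAt ((isOpen_extChartAt_target c).mem_nhds hy)

theorem mdifferentiableAt_extChartAt_symm {c : X} {y : E4}
    (hy : y ∈ (extChartAt (𝓡 4) c).target) :
    MDifferentiableAt 𝓘(ℝ, E4) (𝓡 4) (extChartAt (𝓡 4) c).symm y :=
  (contMDiffAt_extChartAt_symm hy).mdifferentiableAt (by decide)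

theorem chartSymmDerivEnd_det_ne_zero {c : X} {y : E4}
    (hy : y ∈ (extChartAt (𝓡 4) c).target) :
    LinearMap.det (chartSymmDerivEnd c y : E4 →ₗ[ℝ] E4) ≠ 0 := by
  have : IsManifold (𝓡 4) 1 X := IsManifold.of_le (n := ∞) (by decide)
  have h := isInvertible_mfderivWithin_extChartAt_symm (I := 𝓡 4) hy
  rw [ModelWithCorners.range_eq_univ, mfderivWithin_univ] at h
  obtain ⟨e, he⟩ := h
  let e' : E4 ≃L[ℝ] E4 := e
  have he' : chartSymmDerivEnd c y = (e' : E4 →L[ℝ] E4) := he.symm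
  rw [he']
  exact (LinearEquiv.isUnit_det' e'.toLinearEquiv).ne_zero

theorem chartSymmDerivEnd_eq {c m : X} {y : E4} (hy : y ∈ chartOverlap c m) :
    chartSymmDerivEnd c y =
      (chartSymmDerivEnd m (chartTransition c m y)).comp (fderiv ℝ (chartTransition c m) y) := by
  have h1 : chartSymmDerivEnd c y = mfderiv 𝓘(ℝ, E4) (𝓡 4)
      ((extChartAt (𝓡 4) m).symm ∘ chartTransition c m) y :=
    (symm_eventuallyEq hy).mfderiv_eq
  rw [h1]
  have h2 := mfderiv_comp (I := 𝓘(ℝ, E4)) (I' := 𝓘(ℝ, E4)) (I'' := 𝓡 4) y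
    (mdifferentiableAt_extChartAt_symm (chartTransition_mem hy).1)
    (differentiableAt_chartTransition hy).mdifferentiableAt
  rw [mfderiv_eq_fderiv] at h2
  exact h2

theorem algFormInChart_transition {k : ℕ}
    (ω : (x : X) → (TangentSpace (𝓡 4) x) [⋀^Fin k]→L[ℝ] ℝ) {c m : X} {y : E4}
    (hy : y ∈ chartOverlap c m) : algFormInChart ω c y =
      (algFormInChart ω m (chartTransition c m y)).compLinearMap
        (fderiv ℝ (chartTransition c m) y : E4 →ₗ[ℝ] E4) := by
  rw [algFormInChart_eq, algFormInChart_eq, symm_chartTransition hy, chartSymmDerivEnd_eq hy]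
  rfl

theorem isSU2Structure_algFormInChart
    {ω : Fin 3 → (x : X) → (TangentSpace (𝓡 4) x) [⋀^Fin 2]→L[ℝ] ℝ}
    (h : ∀ x, IsSU2Structure (tripleAt ω x)) {c : X} {y : E4}
    (hy : y ∈ (extChartAt (𝓡 4) c).target) :
    IsSU2Structure fun i => algFormInChart (ω i) c y := by
  obtain ⟨h1, h2, h3⟩ := h ((extChartAt (𝓡 4) c).symm y)
  set L : E4 →ₗ[ℝ] E4 := (chartSymmDerivEnd c y : E4 →ₗ[ℝ] E4) with hL
  have hw : ∀ i j, wedge (algFormInChart (ω i) c y) (algFormInChart (ω j) c y) =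
      (wedge (tripleAt ω ((extChartAt (𝓡 4) c).symm y) i)
        (tripleAt ω ((extChartAt (𝓡 4) c).symm y) j)).compLinearMap L := fun i j => by
    rw [algFormInChart_eq, algFormInChart_eq, ← wedge_compLinearMap_two_two]; rfl
  refine ⟨fun i j => by rw [hw, hw, h1 i j], fun i h0 => ?_, fun i j hij => ?_⟩
  · have h4 := topForm_apply_basis_ne_zero (h2 i)
    have h5 := alternating_comp_basis stdBasis4
      (wedge (tripleAt ω ((extChartAt (𝓡 4) c).symm y) i)
        (tripleAt ω ((extChartAt (𝓡 4) c).symm y) i) : E4 [⋀^Fin 4]→ₗ[ℝ] ℝ) L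
    have h6 := congrArg (fun D : E4 [⋀^Fin 4]→ₗ[ℝ] ℝ => D stdBasis4) ((hw i i).symm.trans h0)
    have h7 := h5.symm.trans h6
    exact mul_ne_zero (chartSymmDerivEnd_det_ne_zero hy) h4 h7
  · rw [hw, h3 i j hij]; ext v; rfl

/-- The change of variables formula for a 4-form supported in the intersection of two charts. The
orientation of the atlas makes the Jacobian determinant equal to its absolute value. -/
theorem integral_chart_change (hX : IsOrientedAtlas X) (c m : X)
    {D D' : E4 → E4 [⋀^Fin 4]→ₗ[ℝ] ℝ}
    (hD : ∀ y ∈ chartOverlap c m, D y =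
      (D' (chartTransition c m y)).compLinearMap (fderiv ℝ (chartTransition c m) y : E4 →ₗ[ℝ] E4))
    (h0 : ∀ y ∈ (extChartAt (𝓡 4) c).target, y ∉ chartOverlap c m → D y stdBasis4 = 0)
    (h0' : ∀ y ∈ (extChartAt (𝓡 4) m).target, y ∉ chartOverlap m c → D' y stdBasis4 = 0) :
    ∫ y in (extChartAt (𝓡 4) c).target, D y stdBasis4 =
      ∫ y in (extChartAt (𝓡 4) m).target, D' y stdBasis4 := by
  have e : ∀ (c m : X) (D : E4 → E4 [⋀^Fin 4]→ₗ[ℝ] ℝ)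
      (_ : ∀ y ∈ (extChartAt (𝓡 4) c).target, y ∉ chartOverlap c m → D y stdBasis4 = 0),
      ∫ y in (extChartAt (𝓡 4) c).target, D y stdBasis4 =
        ∫ y in chartOverlap c m, D y stdBasis4 := fun c m D h => by
    refine setIntegral_eq_of_subset_of_forall_sdiff_eq_zero
      (isOpen_extChartAt_target c).measurableSet inter_subset_left ?_
    intro y hy
    exact h y hy.1 hy.2
  rw [e c m D h0, e m c D' h0', ← image_chartTransition c m,
    integral_image_eq_integral_abs_det_fderiv_smul volume (isOpen_chartOverlap c m).measurableSet
      (fun y hy => (differentiableAt_chartTransition hy).hasFDerivAt.hasFDerivWithinAt)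
      (fun y hy z hz h => by
        rw [← chartTransition_chartTransition hy, h, chartTransition_chartTransition hz])]
  refine setIntegral_congr_fun (isOpen_chartOverlap c m).measurableSet fun y hy => ?_
  simp only [smul_eq_mul]
  rw [hD y hy, abs_of_pos (det_fderiv_chartTransition_pos hX hy)]
  exact alternating_comp_basis stdBasis4 _ _

end Charts

end

/-! ### Partition of unity and integration by parts -/

section

open Filter MeasureTheory Set

section Analysis

variable {E : Type*} [NormedAddCommGroup E] [MeasurableSpace E] [BorelSpace E] {μ : Measure E}
  [IsFiniteMeasureOnCompacts μ] {U K : Set E}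

theorem integrableOn_of_continuousOn_of_eq_zero (hU : IsOpen U) (hK : IsCompact K) (hKU : K ⊆ U)
    {h : E → ℝ} (hc : ContinuousOn h U) (h0 : ∀ y ∈ U, y ∉ K → h y = 0) : IntegrableOn h U μ :=
  ((hc.mono hKU).integrableOn_compact hK).of_forall_sdiff_eq_zero hU.measurableSet
    fun y hy => h0 y hy.1 hy.2

variable [NormedSpace ℝ E]

/-- Differentiation under the integral sign, for an integrand with compact support in the
variable of integration. -/
theorem hasDerivAt_integral_mul_of_contDiffAt (hU : IsOpen U) (hK : IsCompact K) (hKU : K ⊆ U)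
    {ρ : E → ℝ} (hρ : ContinuousOn ρ U) (h0 : ∀ y ∈ U, y ∉ K → ρ y = 0) {b : ℝ × E → ℝ}
    (hb : ∀ t, ∀ y ∈ U, ContDiffAt ℝ 1 b (t, y)) (t₀ : ℝ) :
    HasDerivAt (fun t => ∫ y in U, ρ y * b (t, y) ∂μ)
      (∫ y in U, ρ y * fderiv ℝ b (t₀, y) (1, 0) ∂μ) t₀ := by
  have hfd : ∀ t, ∀ y ∈ U, ContinuousAt (fun p => fderiv ℝ b p (1, 0)) (t, y) := fun t y hy =>
    (((hb t y hy).fderiv_right (m := 0) (by norm_num)).continuousAt).clm_apply continuousAt_const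
  have hcb : ∀ t, ContinuousOn (fun y => ρ y * b (t, y)) U := fun t => by
    refine hρ.mul fun y hy => ContinuousAt.continuousWithinAt ?_
    exact ContinuousAt.comp (f := fun y : E => (t, y)) (g := b) (hb t y hy).continuousAt
      (by fun_prop)
  have hcd : ∀ t, ContinuousOn (fun y => ρ y * fderiv ℝ b (t, y) (1, 0)) U := fun t => by
    refine hρ.mul fun y hy => ContinuousAt.continuousWithinAt ?_
    exact ContinuousAt.comp (f := fun y : E => (t, y)) (g := fun p => fderiv ℝ b p (1, 0))
      (hfd t y hy) (by fun_prop)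
  have hcd2 : ContinuousOn (fun p : ℝ × E => ρ p.2 * fderiv ℝ b p (1, 0))
      (Icc (t₀ - 1) (t₀ + 1) ×ˢ K) := by
    refine ContinuousOn.mul ((hρ.mono hKU).comp continuousOn_snd fun p hp => hp.2) ?_
    exact fun p hp => (hfd p.1 p.2 (hKU hp.2)).continuousWithinAt
  obtain ⟨C, hC⟩ := (isCompact_Icc.prod hK).exists_bound_of_continuousOn hcd2
  refine (hasDerivAt_integral_of_dominated_loc_of_deriv_le
    (F := fun t y => ρ y * b (t, y)) (F' := fun t y => ρ y * fderiv ℝ b (t, y) (1, 0))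
    (bound := K.indicator fun _ => C) (s := Icc (t₀ - 1) (t₀ + 1))
    (Icc_mem_nhds (by linarith) (by linarith))
    (Eventually.of_forall fun t => (hcb t).aestronglyMeasurable hU.measurableSet)
    (integrableOn_of_continuousOn_of_eq_zero hU hK hKU (hcb t₀)
      fun y hy hyK => by rw [h0 y hy hyK, zero_mul])
    ((hcd t₀).aestronglyMeasurable hU.measurableSet) ?_ ?_ ?_).2
  · refine (ae_restrict_iff' hU.measurableSet).2 (Eventually.of_forall fun y hy t ht => ?_)
    by_cases hyK : y ∈ K
    · rw [indicator_of_mem hyK]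
      exact hC (t, y) ⟨ht, hyK⟩
    · rw [indicator_of_notMem hyK, h0 y hy hyK, zero_mul, norm_zero]
  · exact ((integrableOn_const hK.measure_lt_top.ne).integrable_indicator
      hK.measurableSet).restrict
  · refine (ae_restrict_iff' hU.measurableSet).2 (Eventually.of_forall fun y hy t _ => ?_)
    have h1 : HasDerivAt (fun t : ℝ => (t, y)) ((1 : ℝ), (0 : E)) t :=
      (hasDerivAt_id t).prodMk (hasDerivAt_const t y)
    exact (((hb t y hy).differentiableAt (by decide)).hasFDerivAt.comp_hasDerivAt t h1).const_mul _

end Analysis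

section Cutoff

variable {X : Type*} [TopologicalSpace X] [ChartedSpace E4 X] [IsManifold (𝓡 4) ∞ X]
  [CompactSpace X] [T2Space X]

variable (X) in
/-- The finitely many indices of nonzero members of the partition of unity. -/
def partitionIndex : Finset X :=
  ((chartPartition X).locallyFinite.finite_nonempty_of_compact).toFinset

theorem chartPartition_eq_zero {k : X} (hk : k ∉ partitionIndex X) (x : X) :
    chartPartition X k x = 0 := by
  by_contra h
  exact hk ((Finite.mem_toFinset _).2 ⟨x, h⟩)

/-- The member with index `k` of the partition of unity, in the chart around `c`. -/
def partitionInChart (k c : X) (y : E4) : ℝ := chartPartition X k ((extChartAt (𝓡 4) c).symm y)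

theorem sum_partitionInChart (c : X) (y : E4) :
    ∑ k ∈ partitionIndex X, partitionInChart k c y = 1 := by
  have h := (chartPartition X).sum_eq_one (mem_univ ((extChartAt (𝓡 4) c).symm y))
  rw [finsum_eq_sum_of_support_subset] at h
  · exact h
  · intro k hk
    by_contra hk'
    exact hk (chartPartition_eq_zero hk' _)

theorem partitionInChart_nonneg (k c : X) (y : E4) : 0 ≤ partitionInChart k c y :=
  (chartPartition X).nonneg _ _

theorem contDiffAt_partitionInChart (k : X) {c : X} {y : E4}
    (hy : y ∈ (extChartAt (𝓡 4) c).target) : ContDiffAt ℝ ∞ (partitionInChart k c) y := by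
  rw [← contMDiffAt_iff_contDiffAt]
  exact (chartPartition X k).contMDiff.contMDiffAt.comp y (contMDiffAt_extChartAt_symm hy)

theorem continuousOn_partitionInChart (k c : X) :
    ContinuousOn (partitionInChart k c) (extChartAt (𝓡 4) c).target := fun _ hy =>
  (contDiffAt_partitionInChart k hy).continuousAt.continuousWithinAt

theorem continuousOn_fderiv_partitionInChart (k c : X) (v : E4) :
    ContinuousOn (fun y => fderiv ℝ (partitionInChart k c) y v) (extChartAt (𝓡 4) c).target :=
  fun _ hy => (((contDiffAt_partitionInChart k hy).fderiv_right (m := 0)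
    (by decide)).continuousAt.clm_apply continuousAt_const).continuousWithinAt

theorem partitionInChart_eventually_zero {k c : X} {y : E4}
    (hy : y ∈ (extChartAt (𝓡 4) c).target)
    (hk : (extChartAt (𝓡 4) c).symm y ∉ tsupport (chartPartition X k)) :
    partitionInChart k c =ᶠ[𝓝 y] 0 := by
  have h1 : ∀ᶠ x in 𝓝 ((extChartAt (𝓡 4) c).symm y), chartPartition X k x = 0 :=
    (notMem_tsupport_iff_eventuallyEq.1 hk)
  exact (continuousAt_extChartAt_symm'' hy).eventually h1

theorem partitionInChart_eventually_zero_of_notMem_overlap {k c : X} {y : E4}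
    (hy : y ∈ (extChartAt (𝓡 4) c).target) (hk : y ∉ chartOverlap c k) :
    partitionInChart k c =ᶠ[𝓝 y] 0 :=
  partitionInChart_eventually_zero hy fun h => hk ⟨hy, by
    rw [mem_preimage, extChartAt_source]
    exact chartPartition_isSubordinate X k h⟩

theorem partitionInChart_transition (k : X) {c m : X} {y : E4} (hy : y ∈ chartOverlap c m) :
    partitionInChart k c y = partitionInChart k m (chartTransition c m y) := by
  rw [partitionInChart, partitionInChart, symm_chartTransition hy]

theorem fderiv_partitionInChart_transition (k : X) {c m : X} {y : E4}
    (hy : y ∈ chartOverlap c m) : fderiv ℝ (partitionInChart k c) y =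
      (fderiv ℝ (partitionInChart k m) (chartTransition c m y)).comp
        (fderiv ℝ (chartTransition c m) y) := by
  have h : partitionInChart k c =ᶠ[𝓝 y] partitionInChart k m ∘ chartTransition c m :=
    eventually_of_mem ((isOpen_chartOverlap c m).mem_nhds hy) fun z hz =>
      partitionInChart_transition k hz
  rw [h.fderiv_eq, fderiv_comp _
    ((contDiffAt_partitionInChart k (chartTransition_mem hy).1).differentiableAt (by decide))
    (differentiableAt_chartTransition hy)]

/-- The support of the cutoff function of the chart around `c`, in this chart. -/
def cutoffSupport (c : X) : Set E4 := extChartAt (𝓡 4) c '' tsupport (chartPartition X c)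

theorem tsupport_subset_source (c : X) :
    tsupport (chartPartition X c) ⊆ (extChartAt (𝓡 4) c).source := by
  rw [extChartAt_source]; exact chartPartition_isSubordinate X c

theorem isCompact_cutoffSupport (c : X) : IsCompact (cutoffSupport c) :=
  (isClosed_tsupport _).isCompact.image_of_continuousOn
    ((continuousOn_extChartAt c).mono (tsupport_subset_source c))

theorem cutoffSupport_subset (c : X) : cutoffSupport c ⊆ (extChartAt (𝓡 4) c).target := by
  rintro _ ⟨x, hx, rfl⟩
  exact (extChartAt (𝓡 4) c).map_source (tsupport_subset_source c hx)

theorem cutoff_eventually_zero {c : X} {y : E4} (hy : y ∈ (extChartAt (𝓡 4) c).target)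
    (hK : y ∉ cutoffSupport c) : partitionInChart c c =ᶠ[𝓝 y] 0 :=
  partitionInChart_eventually_zero hy fun h => hK ⟨_, h, (extChartAt (𝓡 4) c).right_inv hy⟩

theorem cutoff_eq_zero {c : X} {y : E4} (hy : y ∈ (extChartAt (𝓡 4) c).target)
    (hK : y ∉ cutoffSupport c) : partitionInChart c c y = 0 :=
  (cutoff_eventually_zero hy hK).self_of_nhds

theorem integrableOn_cutoff_mul (c : X) {h : E4 → ℝ}
    (hc : ContinuousOn h (extChartAt (𝓡 4) c).target) :
    IntegrableOn (fun y => partitionInChart c c y * h y) (extChartAt (𝓡 4) c).target :=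
  integrableOn_of_continuousOn_of_eq_zero (isOpen_extChartAt_target c) (isCompact_cutoffSupport c)
    (cutoffSupport_subset c) ((continuousOn_partitionInChart c c).mul hc)
    fun y hy hK => by rw [cutoff_eq_zero hy hK, zero_mul]

theorem integrableOn_fderiv_cutoff_mul (c : X) (v : E4) {h : E4 → ℝ}
    (hc : ContinuousOn h (extChartAt (𝓡 4) c).target) :
    IntegrableOn (fun y => fderiv ℝ (partitionInChart c c) y v * h y)
      (extChartAt (𝓡 4) c).target :=
  integrableOn_of_continuousOn_of_eq_zero (isOpen_extChartAt_target c) (isCompact_cutoffSupport c)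
    (cutoffSupport_subset c) ((continuousOn_fderiv_partitionInChart c c v).mul hc)
    fun y hy hK => by rw [(cutoff_eventually_zero hy hK).fderiv_eq]; simp

/-- Integration by parts against a cutoff function. -/
theorem integral_cutoff_mul_fderiv (c : X) (v : E4) {h : E4 → ℝ}
    (hh : ∀ y ∈ (extChartAt (𝓡 4) c).target, ContDiffAt ℝ 1 h y) :
    ∫ y in (extChartAt (𝓡 4) c).target, partitionInChart c c y * fderiv ℝ h y v =
      -∫ y in (extChartAt (𝓡 4) c).target, fderiv ℝ (partitionInChart c c) y v * h y := by
  set U := (extChartAt (𝓡 4) c).target with hU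
  have hUo : IsOpen U := isOpen_extChartAt_target c
  -- extend the cutoff function by zero, since the inverse chart is junk outside `U`
  set f : E4 → ℝ := U.indicator (partitionInChart c c) with hf
  have hfU : ∀ y ∈ U, f =ᶠ[𝓝 y] partitionInChart c c := fun y hy =>
    eventually_of_mem (hUo.mem_nhds hy) fun z hz => indicator_of_mem hz _
  have hfK : ∀ y, y ∉ cutoffSupport c → f =ᶠ[𝓝 y] 0 := fun y hy => by
    refine eventually_of_mem ((isCompact_cutoffSupport c).isClosed.isOpen_compl.mem_nhds hy)
      fun z hz => ?_
    by_cases hzU : z ∈ U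
    · rw [hf, indicator_of_mem hzU]; exact cutoff_eq_zero hzU hz
    · exact indicator_of_notMem hzU _
  have hts : tsupport f ⊆ cutoffSupport c := fun y hy => by
    by_contra hK
    exact notMem_tsupport_iff_eventuallyEq.2 (hfK y hK) hy
  have hcd : ContinuousOn (fun y => fderiv ℝ h y v) U := fun y hy =>
    ((((hh y hy).fderiv_right (m := 0) (by norm_num)).continuousAt).clm_apply
      continuousAt_const).continuousWithinAt
  have hch : ContinuousOn h U := fun y hy => (hh y hy).continuousAt.continuousWithinAt
  have hfd : ∀ y ∉ U, fderiv ℝ f y = 0 := fun y hy => by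
    rw [(hfK y fun h => hy (cutoffSupport_subset c h)).fderiv_eq]; simp
  -- transfer from the chart to `ℝ⁴`
  have toU : ∀ {F G : E4 → ℝ}, (∀ y ∈ U, F y = G y) → (∀ y ∉ U, F y = 0) →
      ∫ y, F y = ∫ y in U, G y := fun {F G} h1 h2 => by
    rw [← setIntegral_eq_integral_of_forall_compl_eq_zero h2]
    exact setIntegral_congr_fun hUo.measurableSet h1
  have toI : ∀ {F G : E4 → ℝ}, (∀ y ∈ U, F y = G y) → (∀ y ∉ U, F y = 0) →
      IntegrableOn G U → Integrable F := fun {F G} h1 h2 hG => by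
    rw [← integrableOn_iff_integrable_of_support_subset (s := U)
      fun y hy => by by_contra h; exact hy (h2 y h)]
    exact hG.congr_fun (fun y hy => (h1 y hy).symm) hUo.measurableSet
  have f1 : ∀ y ∈ U, f y = partitionInChart c c y := fun y hy => (hfU y hy).self_of_nhds
  have f2 : ∀ y ∉ U, f y = 0 := fun y hy => indicator_of_notMem hy _
  have e := integral_mul_fderiv_eq_neg_fderiv_mul_of_integrable (μ := volume) (f := f) (g := h)
    (v := v)
    (toI (fun y hy => by rw [(hfU y hy).fderiv_eq]) (fun y hy => by rw [hfd y hy]; simp)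
      (integrableOn_fderiv_cutoff_mul c v hch))
    (toI (fun y hy => by rw [f1 y hy]) (fun y hy => by rw [f2 y hy]; simp)
      (integrableOn_cutoff_mul c hcd))
    (toI (fun y hy => by rw [f1 y hy]) (fun y hy => by rw [f2 y hy]; simp)
      (integrableOn_cutoff_mul c hch))
    (fun y _ => by
      by_cases hy : y ∈ U
      · exact ((contDiffAt_partitionInChart c hy).differentiableAt
          (by decide)).congr_of_eventuallyEq (hfU y hy)
      · exact (differentiableAt_const (0 : ℝ)).congr_of_eventuallyEq
          (hfK y fun h => hy (cutoffSupport_subset c h)))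
    (fun y hy => (hh y (cutoffSupport_subset c (hts hy))).differentiableAt (by decide))
  rw [toU (fun y hy => by rw [f1 y hy]) (fun y hy => by rw [f2 y hy]; simp),
    toU (fun y hy => by rw [(hfU y hy).fderiv_eq]) (fun y hy => by rw [hfd y hy]; simp)] at e
  exact e

end Cutoff

end

/-! ### The pairing and the energy in charts -/

section

open Filter MeasureTheory Set

section ChartFormulas

variable {X : Type*} [TopologicalSpace X] [ChartedSpace E4 X]

/-- A map to `T/{±1}`, in the chart around `c`. -/
def mapInChart (f : X → TorusQuot) (c : X) : E4 → TorusQuot := f ∘ (extChartAt (𝓡 4) c).symm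

/-- The derivative of the lift of a map, as a linear map on `ℝ⁴`, the space on which the tangent
spaces are modelled. -/
def SmoothOrbMap.liftDerivEnd (f : SmoothOrbMap (𝓡 4) X) (x : X) : E4 →L[ℝ] E3 := f.liftDeriv x

theorem SmoothOrbMap.lift_spec {E H : Type*} [NormedAddCommGroup E] [NormedSpace ℝ E]
    [TopologicalSpace H] {I : ModelWithCorners ℝ E H} {M : Type*} [TopologicalSpace M]
    [ChartedSpace H M] (f : SmoothOrbMap I M) (p : M) :
    ContMDiffAt I 𝓘(ℝ, E3) ∞ (f.lift p) p ∧ ∀ᶠ x in 𝓝 p, orbProj (f.lift p x) = f.toFun x := by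
  obtain ⟨V, hV, hp, h1, h2⟩ := (f.exists_lift p).choose_spec
  exact ⟨h1.contMDiffAt (hV.mem_nhds hp), eventually_of_mem (hV.mem_nhds hp) h2⟩

/-- The lift of `f` around the point with coordinates `y`, in the chart around `c`. -/
def SmoothOrbMap.liftInChart (f : SmoothOrbMap (𝓡 4) X) (c : X) (y : E4) : E4 → E3 :=
  f.lift ((extChartAt (𝓡 4) c).symm y) ∘ (extChartAt (𝓡 4) c).symm

/-- The coefficient of `ω ∧ f^*Θⱼ` in the chart around `c`. -/
def pairingDensity (ω : (x : X) → (TangentSpace (𝓡 4) x) [⋀^Fin 2]→L[ℝ] ℝ) (θ : TorusCoframe)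
    (j : Fin 3) (f : X → TorusQuot) (c : X) (y : E4) : ℝ :=
  (wedge (algFormInChart ω c y) (θ.orbTwoForm j (mapInChart f c) y) : E4 [⋀^Fin 4]→ₗ[ℝ] ℝ)
    stdBasis4

/-- The pullback of a form by a lift of `f`, as a form on `ℝ⁴`, the space on which the tangent
spaces are modelled. -/
def SmoothOrbMap.pullbackEnd (f : SmoothOrbMap (𝓡 4) X) {k : ℕ} (Θ : E3 → E3 [⋀^Fin k]→ₗ[ℝ] ℝ)
    (x : X) : E4 [⋀^Fin k]→ₗ[ℝ] ℝ := f.pullback Θ x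

theorem contDiffOn_algFormInChart {k : ℕ}
    {ω : (x : X) → (TangentSpace (𝓡 4) x) [⋀^Fin k]→L[ℝ] ℝ}
    (hω : IsClosedForm ω) (c : X) (v : Fin k → E4) :
    ContDiffOn ℝ ∞ (fun y => algFormInChart ω c y v) (extChartAt (𝓡 4) c).target :=
  (ContinuousAlternatingMap.apply ℝ E4 ℝ v).contDiff.comp_contDiffOn (hω.smooth c)

variable [IsManifold (𝓡 4) ∞ X]

theorem SmoothOrbMap.isLiftAt (f : SmoothOrbMap (𝓡 4) X) {c : X} {y : E4}
    (hy : y ∈ (extChartAt (𝓡 4) c).target) :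
    IsLiftAt (mapInChart f.toFun c) y (f.liftInChart c y) := by
  obtain ⟨h1, h2⟩ := f.lift_spec ((extChartAt (𝓡 4) c).symm y)
  constructor
  · have := h1.comp y (contMDiffAt_extChartAt_symm hy)
    exact (contMDiffAt_iff_contDiffAt.1 this).of_le (by decide)
  · exact (continuousAt_extChartAt_symm'' hy).eventually h2

theorem SmoothOrbMap.fderiv_liftInChart (f : SmoothOrbMap (𝓡 4) X) {c : X} {y : E4}
    (hy : y ∈ (extChartAt (𝓡 4) c).target) : fderiv ℝ (f.liftInChart c y) y =
      (f.liftDerivEnd ((extChartAt (𝓡 4) c).symm y)).comp (chartSymmDerivEnd c y) := by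
  obtain ⟨h1, -⟩ := f.lift_spec ((extChartAt (𝓡 4) c).symm y)
  have h := mfderiv_comp (I := 𝓘(ℝ, E4)) (I' := 𝓡 4) (I'' := 𝓘(ℝ, E3)) y
    (h1.mdifferentiableAt (by decide)) (mdifferentiableAt_extChartAt_symm hy)
  rw [mfderiv_eq_fderiv] at h
  exact h

theorem SmoothOrbMap.pull_liftInChart (f : SmoothOrbMap (𝓡 4) X) (θ : TorusCoframe) {c : X} {y : E4}
    (hy : y ∈ (extChartAt (𝓡 4) c).target) (i : Fin 3) :
    θ.pull (f.liftInChart c y) y i =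
      ((θ.form i (f.lift ((extChartAt (𝓡 4) c).symm y)
        ((extChartAt (𝓡 4) c).symm y))).toAlternatingMap.compLinearMap
        (f.liftDerivEnd ((extChartAt (𝓡 4) c).symm y) : E4 →ₗ[ℝ] E3)).compLinearMap
          (chartSymmDerivEnd c y : E4 →ₗ[ℝ] E4) := by
  rw [TorusCoframe.pull, f.fderiv_liftInChart hy]
  rfl

/-- The 4-form `ω ∧ f^*Θⱼ` on the coordinate frame. -/
theorem SmoothOrbMap.wedge_pullback_frame (f : SmoothOrbMap (𝓡 4) X)
    (ω : (x : X) → (TangentSpace (𝓡 4) x) [⋀^Fin 2]→L[ℝ] ℝ) (θ : TorusCoframe) (j : Fin 3)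
    {c : X} {y : E4} (hy : y ∈ (extChartAt (𝓡 4) c).target) :
    (wedge (algFormAt ω ((extChartAt (𝓡 4) c).symm y))
      (f.pullbackEnd (θ.bigTheta j) ((extChartAt (𝓡 4) c).symm y)) : E4 [⋀^Fin 4]→ₗ[ℝ] ℝ)
        (fun a => chartSymmDerivEnd c y (stdBasis4 a)) =
      pairingDensity ω θ j f.toFun c y := by
  have h1 : θ.orbTwoForm j (mapInChart f.toFun c) y =
      (f.pullbackEnd (θ.bigTheta j) ((extChartAt (𝓡 4) c).symm y)).compLinearMap
        (chartSymmDerivEnd c y : E4 →ₗ[ℝ] E4) := by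
    rw [(f.isLiftAt hy).orbTwoForm_eq θ j, f.pull_liftInChart θ hy, f.pull_liftInChart θ hy,
      ← wedge_compLinearMap_one_one, ← wedge_compLinearMap_one_one]
    rfl
  rw [pairingDensity, h1, algFormInChart_eq]
  exact congrArg (fun D : E4 [⋀^Fin 4]→ₗ[ℝ] ℝ => D stdBasis4)
    (wedge_compLinearMap_two_two (algFormAt ω ((extChartAt (𝓡 4) c).symm y))
      (f.pullbackEnd (θ.bigTheta j) ((extChartAt (𝓡 4) c).symm y))
      (chartSymmDerivEnd c y : E4 →ₗ[ℝ] E4))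

/-- The density `‖df‖² dvol` on the coordinate frame. -/
theorem SmoothOrbMap.energy_frame (f : SmoothOrbMap (𝓡 4) X)
    (ω : Fin 3 → (x : X) → (TangentSpace (𝓡 4) x) [⋀^Fin 2]→L[ℝ] ℝ) (θ : TorusCoframe)
    {c : X} {y : E4} (hy : y ∈ (extChartAt (𝓡 4) c).target) :
    f.normSqDeriv (fun x => tripleMetric (tripleAt ω x)) θ ((extChartAt (𝓡 4) c).symm y) *
      √(Matrix.det (Matrix.of fun a b => tripleMetric (tripleAt ω ((extChartAt (𝓡 4) c).symm y))
        (chartSymmDerivEnd c y (stdBasis4 a)) (chartSymmDerivEnd c y (stdBasis4 b)))) =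
      energyDensity (fun i => algFormInChart (ω i) c y) (θ.orbMetric (mapInChart f.toFun c) y) := by
  set x := (extChartAt (𝓡 4) c).symm y with hx
  set L : E4 →ₗ[ℝ] E4 := (chartSymmDerivEnd c y : E4 →ₗ[ℝ] E4) with hL
  have hdet : LinearMap.det L ≠ 0 := chartSymmDerivEnd_det_ne_zero hy
  let a : Fin 3 → E4 [⋀^Fin 1]→ₗ[ℝ] ℝ := fun i =>
    (θ.form i (f.lift x x)).toAlternatingMap.compLinearMap (f.liftDerivEnd x : E4 →ₗ[ℝ] E3)
  have hq : θ.orbMetric (mapInChart f.toFun c) y = fun u v => sumSq a (L u) (L v) := by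
    rw [(f.isLiftAt hy).orbMetric_eq θ]
    funext u v
    rw [← sumSq_compLinearMap]
    congr 1
    funext i
    exact f.pull_liftInChart θ hy i
  have hn : f.normSqDeriv (fun x => tripleMetric (tripleAt ω x)) θ x =
      metricTrace (tripleMetric (tripleAt ω x)) (sumSq a) := by
    unfold SmoothOrbMap.normSqDeriv
    congr 1
    funext u v
    unfold TorusCoframe.metric sumSq
    simp only [a, compLinearMap_one_apply]
    rfl
  have hg : tripleMetric (fun i => algFormInChart (ω i) c y) =
      fun u v => tripleMetric (tripleAt ω x) (L u) (L v) := by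
    funext u v
    exact tripleMetric_compLinearMap (tripleAt ω x) hdet u v
  have ht := metricTrace_comp (tripleMetricBilin (tripleAt ω x)) (sumSqBilin a) hdet
  simp only [tripleMetricBilin_apply, sumSqBilin, LinearMap.mk₂_apply] at ht
  unfold energyDensity
  rw [hn, hg, hq, ht]
  rfl

theorem continuousOn_pairingDensity (f : SmoothOrbMap (𝓡 4) X)
    {ω : (x : X) → (TangentSpace (𝓡 4) x) [⋀^Fin 2]→L[ℝ] ℝ} (hω : IsClosedForm ω)
    (θ : TorusCoframe) (j : Fin 3) (c : X) :
    ContinuousOn (pairingDensity ω θ j f.toFun c) (extChartAt (𝓡 4) c).target := by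
  have e : pairingDensity ω θ j f.toFun c = _ :=
    funext fun y => wedge_two_two_apply (algFormInChart ω c y) _ stdBasis4
  rw [e]
  have h1 := fun a b => (contDiffOn_algFormInChart hω c ![stdBasis4 a, stdBasis4 b]).continuousOn
  have h2 : ∀ a b, ContinuousOn (fun y => θ.orbTwoForm j (mapInChart f.toFun c) y
      ![stdBasis4 a, stdBasis4 b]) (extChartAt (𝓡 4) c).target := fun a b y hy =>
    ((f.isLiftAt hy).contDiffAt_orbTwoForm θ j _ _).continuousAt.continuousWithinAt
  exact (((((((h1 0 1).mul (h2 2 3)).sub ((h1 0 2).mul (h2 1 3))).add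
    ((h1 0 3).mul (h2 1 2))).add ((h1 1 2).mul (h2 0 3))).sub ((h1 1 3).mul (h2 0 2))).add
    ((h1 2 3).mul (h2 0 1)))

theorem continuousOn_energyDensity (f : SmoothOrbMap (𝓡 4) X)
    {ω : Fin 3 → (x : X) → (TangentSpace (𝓡 4) x) [⋀^Fin 2]→L[ℝ] ℝ} (hω : IsHyperKahlerTriple ω)
    (θ : TorusCoframe) (c : X) :
    ContinuousOn (fun y => energyDensity (fun i => algFormInChart (ω i) c y)
      (θ.orbMetric (mapInChart f.toFun c) y)) (extChartAt (𝓡 4) c).target := by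
  have hsu := fun y (hy : y ∈ (extChartAt (𝓡 4) c).target) =>
    isSU2Structure_algFormInChart hω.isSU2Structure hy
  have h1 := fun i a b =>
    (contDiffOn_algFormInChart (hω.closed i) c ![stdBasis4 a, stdBasis4 b]).continuousOn
  have hpf : ContinuousOn (fun y => pfaffianPair
      (Matrix.of fun a b => algFormInChart (ω 0) c y ![stdBasis4 a, stdBasis4 b])
      (Matrix.of fun a b => algFormInChart (ω 0) c y ![stdBasis4 a, stdBasis4 b]))
      (extChartAt (𝓡 4) c).target := by
    simp only [pfaffianPair, Matrix.of_apply]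
    fun_prop
  have hpf0 : ∀ y ∈ (extChartAt (𝓡 4) c).target, pfaffianPair
      (Matrix.of fun a b => algFormInChart (ω 0) c y ![stdBasis4 a, stdBasis4 b])
      (Matrix.of fun a b => algFormInChart (ω 0) c y ![stdBasis4 a, stdBasis4 b]) ≠ 0 := by
    intro y hy h0
    refine topForm_apply_basis_ne_zero ((hsu y hy).sq_ne_zero 0) ?_
    exact (wedge_two_two_apply _ _ stdBasis4).trans h0
  have hS : ∀ a b, ContinuousOn (fun y => tripleTensor (fun i => algFormInChart (ω i) c y)
      (stdBasis4 a) (stdBasis4 b)) (extChartAt (𝓡 4) c).target := by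
    intro a b
    simp only [tripleTensor_eq]
    refine ContinuousOn.div ?_ hpf hpf0
    fun_prop
  have hSm : ContinuousOn (fun y => Matrix.of fun a b =>
      tripleTensor (fun i => algFormInChart (ω i) c y) (stdBasis4 a) (stdBasis4 b))
      (extChartAt (𝓡 4) c).target :=
    continuousOn_pi.2 fun a => continuousOn_pi.2 fun b => hS a b
  have hq : ContinuousOn (fun y => Matrix.of fun a b =>
      θ.orbMetric (mapInChart f.toFun c) y (stdBasis4 a) (stdBasis4 b))
      (extChartAt (𝓡 4) c).target :=
    continuousOn_pi.2 fun a => continuousOn_pi.2 fun b => fun y hy =>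
      ((f.isLiftAt hy).continuousAt_orbMetric θ _ _).continuousWithinAt
  have hdet : ContinuousOn (fun y => Matrix.det (Matrix.of fun a b =>
      tripleTensor (fun i => algFormInChart (ω i) c y) (stdBasis4 a) (stdBasis4 b)))
      (extChartAt (𝓡 4) c).target := continuous_id.matrix_det.comp_continuousOn hSm
  have hinv : ContinuousOn (fun y => (Matrix.of fun a b =>
      tripleTensor (fun i => algFormInChart (ω i) c y) (stdBasis4 a) (stdBasis4 b))⁻¹)
      (extChartAt (𝓡 4) c).target := by
    simp only [Matrix.inv_def, Ring.inverse_eq_inv']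
    exact (hdet.inv₀ fun y hy => (hsu y hy).det_tripleTensor_ne_zero).smul
      (continuous_id.matrix_adjugate.comp_continuousOn hSm)
  have hmul : ContinuousOn (fun y => |metricTrace (tripleTensor fun i => algFormInChart (ω i) c y)
      (θ.orbMetric (mapInChart f.toFun c) y) * √(Matrix.det (Matrix.of fun a b =>
        tripleTensor (fun i => algFormInChart (ω i) c y) (stdBasis4 a) (stdBasis4 b)))|)
      (extChartAt (𝓡 4) c).target := by
    refine ContinuousOn.abs (ContinuousOn.mul ?_ hdet.sqrt)
    exact continuous_id.matrix_trace.comp_continuousOn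
      ((continuous_fst.matrix_mul continuous_snd).comp_continuousOn (hinv.prodMk hq))
  exact hmul.congr fun y hy => (hsu y hy).energyDensity_eq _

variable [CompactSpace X] [T2Space X]

/-- The integral over `X` as a finite sum of integrals in charts. -/
theorem integralTop_eq_sum {D : (x : X) → (Fin 4 → TangentSpace (𝓡 4) x) → ℝ}
    {d : X → E4 → ℝ}
    (h : ∀ c, ∀ y ∈ (extChartAt (𝓡 4) c).target, D ((extChartAt (𝓡 4) c).symm y)
      (fun a => chartSymmDeriv c y (stdBasis4 a)) = d c y) :
    integralTop D = ∑ c ∈ partitionIndex X,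
      ∫ y in (extChartAt (𝓡 4) c).target, partitionInChart c c y * d c y := by
  unfold integralTop
  rw [finsum_eq_sum_of_support_subset (s := partitionIndex X)]
  · refine Finset.sum_congr rfl fun c _ => ?_
    refine setIntegral_congr_fun (isOpen_extChartAt_target c).measurableSet fun y hy => ?_
    simp only [partitionInChart, h c y hy]
  · intro c hc
    by_contra hc'
    refine hc ?_
    simp [chartPartition_eq_zero hc']

theorem SmoothOrbMap.pairing_eq (f : SmoothOrbMap (𝓡 4) X)
    (ω : Fin 3 → (x : X) → (TangentSpace (𝓡 4) x) [⋀^Fin 2]→L[ℝ] ℝ) (θ : TorusCoframe)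
    (i j : Fin 3) : f.pairing ω θ i j = ∑ c ∈ partitionIndex X,
      ∫ y in (extChartAt (𝓡 4) c).target,
        partitionInChart c c y * pairingDensity (ω i) θ j f.toFun c y :=
  integralTop_eq_sum
    (D := fun x v => (wedge (ω i x).toAlternatingMap (f.pullback (θ.bigTheta j) x) :
      (TangentSpace (𝓡 4) x) [⋀^Fin 4]→ₗ[ℝ] ℝ) v)
    (d := pairingDensity (ω i) θ j f.toFun)
    fun _ _ hy => f.wedge_pullback_frame (ω i) θ j hy

theorem SmoothOrbMap.energy_eq (f : SmoothOrbMap (𝓡 4) X)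
    (ω : Fin 3 → (x : X) → (TangentSpace (𝓡 4) x) [⋀^Fin 2]→L[ℝ] ℝ) (θ : TorusCoframe) :
    f.energy (fun x => tripleMetric (tripleAt ω x)) θ = ∑ c ∈ partitionIndex X,
      ∫ y in (extChartAt (𝓡 4) c).target, partitionInChart c c y *
        energyDensity (fun i => algFormInChart (ω i) c y)
          (θ.orbMetric (mapInChart f.toFun c) y) :=
  integralTop_eq_sum
    (D := fun x v => f.normSqDeriv (fun x => tripleMetric (tripleAt ω x)) θ x *
      √(Matrix.det (Matrix.of fun a b => tripleMetric (tripleAt ω x) (v a) (v b))))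
    (d := fun c y => energyDensity (fun i => algFormInChart (ω i) c y)
      (θ.orbMetric (mapInChart f.toFun c) y))
    fun _ _ hy => f.energy_frame ω θ hy

theorem SmoothOrbMap.sum_pairing_le_energy (f : SmoothOrbMap (𝓡 4) X)
    {ω : Fin 3 → (x : X) → (TangentSpace (𝓡 4) x) [⋀^Fin 2]→L[ℝ] ℝ} (hω : IsHyperKahlerTriple ω)
    (θ : TorusCoframe) :
    ∑ i, f.pairing ω θ i i ≤ f.energy (fun x => tripleMetric (tripleAt ω x)) θ := by
  simp only [f.pairing_eq, f.energy_eq]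
  rw [Finset.sum_comm]
  refine Finset.sum_le_sum fun c _ => ?_
  have hint := fun i =>
    integrableOn_cutoff_mul c (continuousOn_pairingDensity f (hω.closed i) θ i c)
  rw [← integral_finsetSum _ fun i _ => hint i]
  refine setIntegral_mono_on (integrable_finsetSum _ fun i _ => hint i)
    (integrableOn_cutoff_mul c (continuousOn_energyDensity f hω θ c))
    (isOpen_extChartAt_target c).measurableSet fun y hy => ?_
  rw [← Finset.mul_sum]
  refine mul_le_mul_of_nonneg_left ?_ (partitionInChart_nonneg c c y)
  exact (le_abs_self _).trans
    ((isSU2Structure_algFormInChart hω.isSU2Structure hy).abs_topSum_le _)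

end ChartFormulas

end

/-! ### Homotopy invariance of the pairing -/

section

open Filter MeasureTheory Set

section Family

/-- The 1-form `ι_{∂ₜ} β`, restricted to the slices `t = const`. -/
def contractTime (β : (ℝ × E4) [⋀^Fin 2]→ₗ[ℝ] ℝ) : E4 [⋀^Fin 1]→ₗ[ℝ] ℝ :=
  (β.curryLeft (1, 0)).compLinearMap (LinearMap.inr ℝ ℝ E4)

theorem contractTime_apply (β : (ℝ × E4) [⋀^Fin 2]→ₗ[ℝ] ℝ) (v : E4) :
    contractTime β ![v] = β ![(1, 0), (0, v)] := by
  rw [contractTime, compLinearMap_one_apply]; rfl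

/-- The differential of a function, as an algebraic 1-form. -/
def differentialForm (χ : E4 → ℝ) (y : E4) : E4 [⋀^Fin 1]→ₗ[ℝ] ℝ :=
  AlternatingMap.ofSubsingleton ℝ E4 ℝ 0 (fderiv ℝ χ y).toLinearMap

theorem differentialForm_apply (χ : E4 → ℝ) (y v : E4) :
    differentialForm χ y ![v] = fderiv ℝ χ y v := rfl

variable {X : Type*} [TopologicalSpace X] [ChartedSpace E4 X]

/-- A family of maps to `T/{±1}`, in the chart around `c`. -/
def familyInChart (F : ℝ → X → TorusQuot) (c : X) (p : ℝ × E4) : TorusQuot :=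
  F p.1 ((extChartAt (𝓡 4) c).symm p.2)

/-- A family of maps to `T/{±1}`, parametrised by `ℝ`, that in every chart has local lifts to `ℝ³`
of class `C²` in the parameter and the coordinates together. -/
def IsSmoothFamily (F : ℝ → X → TorusQuot) : Prop :=
  ∀ c : X, ∀ t : ℝ, ∀ y ∈ (extChartAt (𝓡 4) c).target,
    ∃ G, IsLiftAt (familyInChart F c) (t, y) G

variable {F : ℝ → X → TorusQuot} (θ : TorusCoframe) (j : Fin 3)

theorem IsSmoothFamily.orbTwoForm_slice (hF : IsSmoothFamily F) {c : X} {t : ℝ} {y : E4}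
    (hy : y ∈ (extChartAt (𝓡 4) c).target) :
    θ.orbTwoForm j (mapInChart (F t) c) y =
      (θ.orbTwoForm j (familyInChart F c) (t, y)).compLinearMap (LinearMap.inr ℝ ℝ E4) := by
  obtain ⟨G, hG⟩ := hF c t y hy
  have h1 : fderiv ℝ (fun y : E4 => (t, y)) y = ContinuousLinearMap.inr ℝ ℝ E4 :=
    (hasFDerivAt_prodMk_right t y).fderiv
  have h2 := IsLiftAt.orbTwoForm_comp (τ := fun y : E4 => (t, y)) (p' := y)
    (Φ' := mapInChart (F t) c) θ j hG (by fun_prop) (EventuallyEq.refl _ _)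
  rw [h2, h1]
  rfl

theorem IsSmoothFamily.contDiffAt (hF : IsSmoothFamily F) {c : X} {t : ℝ} {y : E4}
    (hy : y ∈ (extChartAt (𝓡 4) c).target) (u v : ℝ × E4) :
    ContDiffAt ℝ 1 (fun p => θ.orbTwoForm j (familyInChart F c) p ![u, v]) (t, y) := by
  obtain ⟨G, hG⟩ := hF c t y hy
  exact hG.contDiffAt_orbTwoForm θ j u v

theorem fderiv_slice {B : ℝ × E4 → ℝ} {t : ℝ} {y : E4} (hB : DifferentiableAt ℝ B (t, y))
    (v : E4) : fderiv ℝ (fun y => B (t, y)) y v = fderiv ℝ B (t, y) (0, v) := by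
  have h := HasFDerivAt.comp y hB.hasFDerivAt (hasFDerivAt_prodMk_right (𝕜 := ℝ) t y)
  have h' : fderiv ℝ (fun y => B (t, y)) y = _ := h.fderiv
  rw [h']; simp

/-- `∂ₜ β = d γ`, where `β` is the restriction of `F^*Θⱼ` to the slices and `γ` its contraction
with `∂ₜ`, because `F^*Θⱼ` is closed. -/
theorem IsSmoothFamily.fderiv_time (hF : IsSmoothFamily F) {c : X} {t : ℝ} {y : E4}
    (hy : y ∈ (extChartAt (𝓡 4) c).target) (u v : E4) :
    fderiv ℝ (fun p => θ.orbTwoForm j (familyInChart F c) p ![(0, u), (0, v)]) (t, y) (1, 0) =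
      fderiv ℝ (fun y => contractTime (θ.orbTwoForm j (familyInChart F c) (t, y)) ![v]) y u -
      fderiv ℝ (fun y => contractTime (θ.orbTwoForm j (familyInChart F c) (t, y)) ![u]) y v := by
  obtain ⟨G, hG⟩ := hF c t y hy
  have h1 := hG.fderiv_orbTwoForm_cyclic θ j (1, 0) (0, u) (0, v)
  have h2 : (fun p => θ.orbTwoForm j (familyInChart F c) p ![((0 : ℝ), v), (1, 0)]) =
      fun p => -θ.orbTwoForm j (familyInChart F c) p ![(1, 0), (0, v)] :=
    funext fun p => alternating_two_swap _ _ _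
  rw [h2, fderiv_fun_neg] at h1
  simp only [contractTime_apply]
  have hd := fun w =>
    (hF.contDiffAt θ j hy (t := t) (1, 0) ((0 : ℝ), w)).differentiableAt (by decide)
  rw [fderiv_slice (hd v), fderiv_slice (hd u)]
  simp only [neg_apply] at h1
  linarith

theorem fderiv_time_mul {w : E4 → ℝ} {B : ℝ × E4 → ℝ} {t : ℝ} {y : E4}
    (hw : DifferentiableAt ℝ w y) (hB : DifferentiableAt ℝ B (t, y)) :
    fderiv ℝ (fun p : ℝ × E4 => w p.2 * B p) (t, y) (1, 0) = w y * fderiv ℝ B (t, y) (1, 0) := by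
  have h1 : HasFDerivAt (fun p : ℝ × E4 => w p.2)
      ((fderiv ℝ w y).comp (ContinuousLinearMap.snd ℝ ℝ E4)) (t, y) :=
    HasFDerivAt.comp (t, y) (g := w) (f := Prod.snd) hw.hasFDerivAt hasFDerivAt_snd
  have h2 : fderiv ℝ (fun p : ℝ × E4 => w p.2 * B p) (t, y) = _ := (h1.mul hB.hasFDerivAt).fderiv
  rw [h2]
  simp

/-- The closedness of a 2-form in terms of its coefficients in a chart. -/
theorem fderiv_closedForm_coeff {ω : (x : X) → (TangentSpace (𝓡 4) x) [⋀^Fin 2]→L[ℝ] ℝ}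
    (hω : IsClosedForm ω) {c : X} {y : E4} (hy : y ∈ (extChartAt (𝓡 4) c).target) (a b d : E4) :
    fderiv ℝ (fun y => algFormInChart ω c y ![b, d]) y a -
      fderiv ℝ (fun y => algFormInChart ω c y ![a, d]) y b +
      fderiv ℝ (fun y => algFormInChart ω c y ![a, b]) y d = 0 := by
  have hd : DifferentiableAt ℝ (formInChart ω c) y :=
    ((hω.smooth c).contDiffAt ((isOpen_extChartAt_target c).mem_nhds hy)).differentiableAt
      (by decide)
  have h := extDeriv_apply hd ![a, b, d]
  rw [hω.closed c y hy] at h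
  have e0 : (0 : Fin 3).removeNth ![a, b, d] = ![b, d] := by ext j; fin_cases j <;> rfl
  have e1 : (1 : Fin 3).removeNth ![a, b, d] = ![a, d] := by ext j; fin_cases j <;> rfl
  have e2 : (2 : Fin 3).removeNth ![a, b, d] = ![a, b] := by ext j; fin_cases j <;> rfl
  rw [Fin.sum_univ_three, e0, e1, e2] at h
  simp at h
  have e : ∀ u v : E4, (fun y => algFormInChart ω c y ![u, v]) =
    fun y => formInChart ω c y ![u, v] := fun u v => rfl
  rw [e, e, e]
  linarith

theorem IsSmoothFamily.pairingDensity_eventuallyEq (hF : IsSmoothFamily F)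
    (ω : (x : X) → (TangentSpace (𝓡 4) x) [⋀^Fin 2]→L[ℝ] ℝ) {c : X} {t : ℝ} {y : E4}
    (hy : y ∈ (extChartAt (𝓡 4) c).target) :
    (fun p : ℝ × E4 => pairingDensity ω θ j (F p.1) c p.2) =ᶠ[𝓝 (t, y)] fun p =>
      let w := fun a b => algFormInChart ω c p.2 ![stdBasis4 a, stdBasis4 b]
      let B := fun a b => θ.orbTwoForm j (familyInChart F c) p
        ![(0, stdBasis4 a), (0, stdBasis4 b)]
      w 0 1 * B 2 3 - w 0 2 * B 1 3 + w 0 3 * B 1 2 + w 1 2 * B 0 3 - w 1 3 * B 0 2 +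
        w 2 3 * B 0 1 := by
  have : ∀ᶠ p : ℝ × E4 in 𝓝 (t, y), p.2 ∈ (extChartAt (𝓡 4) c).target :=
    continuousAt_snd.eventually ((isOpen_extChartAt_target c).mem_nhds hy)
  filter_upwards [this] with p hp
  refine (wedge_two_two_apply _ _ stdBasis4).trans ?_
  rw [hF.orbTwoForm_slice θ j hp]
  simp only [compLinearMap_two_apply]
  rfl

theorem IsSmoothFamily.contDiffAt_pairingDensity (hF : IsSmoothFamily F)
    {ω : (x : X) → (TangentSpace (𝓡 4) x) [⋀^Fin 2]→L[ℝ] ℝ} (hω : IsClosedForm ω) {c : X} {t : ℝ}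
    {y : E4} (hy : y ∈ (extChartAt (𝓡 4) c).target) :
    ContDiffAt ℝ 1 (fun p : ℝ × E4 => pairingDensity ω θ j (F p.1) c p.2) (t, y) := by
  refine ContDiffAt.congr_of_eventuallyEq ?_ (hF.pairingDensity_eventuallyEq θ j ω hy)
  have h1 : ∀ a b, ContDiffAt ℝ 1 (fun p : ℝ × E4 =>
      algFormInChart ω c p.2 ![stdBasis4 a, stdBasis4 b]) (t, y) := fun a b =>
    ContDiffAt.comp (t, y) (g := fun y => algFormInChart ω c y ![stdBasis4 a, stdBasis4 b])
      (((contDiffOn_algFormInChart hω c _).contDiffAt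
        ((isOpen_extChartAt_target c).mem_nhds hy)).of_le (by decide)) contDiffAt_snd
  have h2 := fun a b => hF.contDiffAt θ j hy (t := t) ((0 : ℝ), stdBasis4 a) (0, stdBasis4 b)
  exact (((((((h1 0 1).mul (h2 2 3)).sub ((h1 0 2).mul (h2 1 3))).add
    ((h1 0 3).mul (h2 1 2))).add ((h1 1 2).mul (h2 0 3))).sub ((h1 1 3).mul (h2 0 2))).add
    ((h1 2 3).mul (h2 0 1)))

theorem IsSmoothFamily.contractTime_transition [IsManifold (𝓡 4) ∞ X]
    (hF : IsSmoothFamily F) {c m : X} (t : ℝ) {y : E4}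
    (hy : y ∈ chartOverlap c m) :
    contractTime (θ.orbTwoForm j (familyInChart F c) (t, y)) =
      (contractTime (θ.orbTwoForm j (familyInChart F m) (t, chartTransition c m y))).compLinearMap
        (fderiv ℝ (chartTransition c m) y : E4 →ₗ[ℝ] E4) := by
  obtain ⟨G, hG⟩ := hF m t _ (chartTransition_mem hy).1
  let τ : ℝ × E4 → ℝ × E4 := Prod.map id (chartTransition c m)
  have hτd : HasFDerivAt τ
      ((ContinuousLinearMap.id ℝ ℝ).prodMap (fderiv ℝ (chartTransition c m) y)) (t, y) :=
    HasFDerivAt.prodMap (t, y) (hasFDerivAt_id t) (differentiableAt_chartTransition hy).hasFDerivAt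
  have hτ : ContDiffAt ℝ 2 τ (t, y) :=
    ContDiffAt.prodMap' contDiffAt_id ((contDiffAt_chartTransition hy).of_le (by decide))
  have hΦ : familyInChart F c =ᶠ[𝓝 (t, y)] familyInChart F m ∘ τ := by
    have : ∀ᶠ p : ℝ × E4 in 𝓝 (t, y), p.2 ∈ chartOverlap c m :=
      continuousAt_snd.eventually ((isOpen_chartOverlap c m).mem_nhds hy)
    filter_upwards [this] with p hp
    simp only [familyInChart, Function.comp_apply, τ, Prod.map, id, symm_chartTransition hp]
  have h := IsLiftAt.orbTwoForm_comp (τ := τ) (p' := (t, y)) θ j hG hτ hΦ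
  refine alternating_one_ext fun v => ?_
  rw [compLinearMap_one_apply, contractTime_apply, contractTime_apply, h, compLinearMap_two_apply,
    hτd.fderiv]
  simp [τ]

/-- The 4-form `ω ∧ dρₖ ∧ γ` in the chart around `c`, where `γ = ι_{∂ₜ} F^*Θⱼ` and `ρₖ` is a member
of the partition of unity. -/
def fluxForm [IsManifold (𝓡 4) ∞ X] [CompactSpace X] [T2Space X]
    (ω : (x : X) → (TangentSpace (𝓡 4) x) [⋀^Fin 2]→L[ℝ] ℝ) (θ : TorusCoframe) (j : Fin 3)
    (F : ℝ → X → TorusQuot) (k c : X) (t : ℝ) (y : E4) : E4 [⋀^Fin 4]→ₗ[ℝ] ℝ :=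
  wedge (algFormInChart ω c y) (wedge (differentialForm (partitionInChart k c) y)
    (contractTime (θ.orbTwoForm j (familyInChart F c) (t, y))))

/-- The vector field dual to the 3-form `ω ∧ γ`, for a 2-form `ω` with coefficients `w` and a 1-form
with coefficients `γ`; its divergence is the coefficient of `d(ω ∧ γ)`. -/
def dualField (w : Fin 4 → Fin 4 → ℝ) (γ : Fin 4 → ℝ) : Fin 4 → ℝ :=
  ![w 1 2 * γ 3 - w 1 3 * γ 2 + w 2 3 * γ 1, -(w 0 2 * γ 3) + w 0 3 * γ 2 - w 2 3 * γ 0,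
    w 0 1 * γ 3 - w 0 3 * γ 1 + w 1 3 * γ 0, -(w 0 1 * γ 2) + w 0 2 * γ 1 - w 1 2 * γ 0]

variable [IsManifold (𝓡 4) ∞ X] [CompactSpace X] [T2Space X]
  {ω : (x : X) → (TangentSpace (𝓡 4) x) [⋀^Fin 2]→L[ℝ] ℝ}

theorem fluxForm_apply (k c : X) (t : ℝ) (y : E4) :
    fluxForm ω θ j F k c t y stdBasis4 = ∑ a, fderiv ℝ (partitionInChart k c) y (stdBasis4 a) *
      dualField (fun a b => algFormInChart ω c y ![stdBasis4 a, stdBasis4 b])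
        (fun a => contractTime (θ.orbTwoForm j (familyInChart F c) (t, y)) ![stdBasis4 a]) a := by
  have h2 : ∀ a b, wedge (differentialForm (partitionInChart k c) y)
      (contractTime (θ.orbTwoForm j (familyInChart F c) (t, y))) ![stdBasis4 a, stdBasis4 b] = _ :=
    fun a b => wedge_one_one_apply _ _ ![stdBasis4 a, stdBasis4 b]
  refine (wedge_two_two_apply _ _ stdBasis4).trans ?_
  -- the wedge product has degree `1 + 1`, which agrees with `2` only after unfolding
  erw [h2, h2, h2, h2, h2, h2]
  simp only [Matrix.cons_val_zero, Matrix.cons_val_one, differentialForm_apply, dualField,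
    Fin.sum_univ_four, Matrix.cons_val]
  ring

/-- Stokes' theorem in one chart: the time derivative of `ω ∧ β` is `ω ∧ dγ = d(ω ∧ γ)`, the
divergence of the dual field, and integration by parts moves it to the cutoff function. -/
theorem IsSmoothFamily.integral_cutoff_time (hF : IsSmoothFamily F) (hω : IsClosedForm ω)
    (c : X) (t : ℝ) :
    ∫ y in (extChartAt (𝓡 4) c).target, partitionInChart c c y *
        fderiv ℝ (fun p : ℝ × E4 => pairingDensity ω θ j (F p.1) c p.2) (t, y) (1, 0) =
      -∫ y in (extChartAt (𝓡 4) c).target, fluxForm ω θ j F c c t y stdBasis4 := by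
  set U := (extChartAt (𝓡 4) c).target with hU
  have hUo : IsOpen U := isOpen_extChartAt_target c
  set w : Fin 4 → Fin 4 → E4 → ℝ := fun a b y =>
    algFormInChart ω c y ![stdBasis4 a, stdBasis4 b] with hw
  set γ : Fin 4 → E4 → ℝ := fun a y =>
    contractTime (θ.orbTwoForm j (familyInChart F c) (t, y)) ![stdBasis4 a] with hγ
  set V : Fin 4 → E4 → ℝ := fun a y => dualField (fun a b => w a b y) (fun a => γ a y) a with hV
  have hwc : ∀ a b, ∀ y ∈ U, ContDiffAt ℝ 1 (w a b) y := fun a b y hy =>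
    ((contDiffOn_algFormInChart hω c _).contDiffAt (hUo.mem_nhds hy)).of_le (by decide)
  have hγc : ∀ a, ∀ y ∈ U, ContDiffAt ℝ 1 (γ a) y := fun a y hy => by
    simp only [hγ, contractTime_apply]
    exact ContDiffAt.comp y (g := fun p => θ.orbTwoForm j (familyInChart F c) p
      ![((1 : ℝ), (0 : E4)), (0, stdBasis4 a)]) (f := fun y : E4 => (t, y))
      (hF.contDiffAt θ j hy _ _) (by fun_prop)
  have hwd := fun a b y hy => (hwc a b y hy).differentiableAt one_ne_zero
  have hγd := fun a y hy => (hγc a y hy).differentiableAt one_ne_zero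
  have hVc : ∀ a, ∀ y ∈ U, ContDiffAt ℝ 1 (V a) y := by
    intro a y hy
    have h1 := fun a b d => (hwc a b y hy).mul (hγc d y hy)
    fin_cases a
    · exact ((h1 1 2 3).sub (h1 1 3 2)).add (h1 2 3 1)
    · exact ((h1 0 2 3).neg.add (h1 0 3 2)).sub (h1 2 3 0)
    · exact ((h1 0 1 3).sub (h1 0 3 1)).add (h1 1 3 0)
    · exact ((h1 0 1 2).neg.add (h1 0 2 1)).sub (h1 1 2 0)
  have hdiv : ∀ y ∈ U,
      fderiv ℝ (fun p : ℝ × E4 => pairingDensity ω θ j (F p.1) c p.2) (t, y) (1, 0) =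
        ∑ a, fderiv ℝ (V a) y (stdBasis4 a) := by
    intro y hy
    have hcl := fun a b d => fderiv_closedForm_coeff hω hy (stdBasis4 a) (stdBasis4 b) (stdBasis4 d)
    have hBd : ∀ a b, DifferentiableAt ℝ (fun p => θ.orbTwoForm j (familyInChart F c) p
        ![((0 : ℝ), stdBasis4 a), (0, stdBasis4 b)]) (t, y) := fun a b =>
      (hF.contDiffAt θ j hy _ _).differentiableAt one_ne_zero
    have hwd2 : ∀ a b, DifferentiableAt ℝ (fun p : ℝ × E4 => w a b p.2) (t, y) := fun a b =>
      DifferentiableAt.comp (t, y) (g := w a b) (f := Prod.snd) (hwd a b y hy) differentiableAt_snd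
    have hm := fun a b d e => (hwd2 a b).fun_mul (hBd d e)
    have hL : fderiv ℝ (fun p : ℝ × E4 => pairingDensity ω θ j (F p.1) c p.2) (t, y) (1, 0) =
        let B := fun a b => fderiv ℝ (γ b) y (stdBasis4 a) - fderiv ℝ (γ a) y (stdBasis4 b)
        w 0 1 y * B 2 3 - w 0 2 y * B 1 3 + w 0 3 y * B 1 2 + w 1 2 y * B 0 3 -
          w 1 3 y * B 0 2 + w 2 3 y * B 0 1 := by
      rw [(hF.pairingDensity_eventuallyEq θ j ω hy).fderiv_eq]
      simp only []
      rw [fderiv_fun_add (((((hm 0 1 2 3).fun_sub (hm 0 2 1 3)).fun_add (hm 0 3 1 2)).fun_add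
          (hm 1 2 0 3)).fun_sub (hm 1 3 0 2)) (hm 2 3 0 1),
        fderiv_fun_sub ((((hm 0 1 2 3).fun_sub (hm 0 2 1 3)).fun_add (hm 0 3 1 2)).fun_add
          (hm 1 2 0 3)) (hm 1 3 0 2),
        fderiv_fun_add (((hm 0 1 2 3).fun_sub (hm 0 2 1 3)).fun_add (hm 0 3 1 2)) (hm 1 2 0 3),
        fderiv_fun_add ((hm 0 1 2 3).fun_sub (hm 0 2 1 3)) (hm 0 3 1 2),
        fderiv_fun_sub (hm 0 1 2 3) (hm 0 2 1 3)]
      simp only [add_apply, sub_apply]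
      rw [fderiv_time_mul (hwd _ _ y hy) (hBd _ _), fderiv_time_mul (hwd _ _ y hy) (hBd _ _),
        fderiv_time_mul (hwd _ _ y hy) (hBd _ _), fderiv_time_mul (hwd _ _ y hy) (hBd _ _),
        fderiv_time_mul (hwd _ _ y hy) (hBd _ _), fderiv_time_mul (hwd _ _ y hy) (hBd _ _)]
      simp only [hF.fderiv_time θ j hy]
      rfl
    have hp : ∀ a b d, HasFDerivAt (fun y => w a b y * γ d y)
        (w a b y • fderiv ℝ (γ d) y + γ d y • fderiv ℝ (w a b) y) y := fun a b d =>
      (hwd a b y hy).hasFDerivAt.mul (hγd d y hy).hasFDerivAt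
    have v0 : fderiv ℝ (V 0) y = _ := (((hp 1 2 3).sub (hp 1 3 2)).add (hp 2 3 1)).fderiv
    have v1 : fderiv ℝ (V 1) y = _ := (((hp 0 2 3).neg.add (hp 0 3 2)).sub (hp 2 3 0)).fderiv
    have v2 : fderiv ℝ (V 2) y = _ := (((hp 0 1 3).sub (hp 0 3 1)).add (hp 1 3 0)).fderiv
    have v3 : fderiv ℝ (V 3) y = _ := (((hp 0 1 2).neg.add (hp 0 2 1)).sub (hp 1 2 0)).fderiv
    rw [hL, Fin.sum_univ_four, v0, v1, v2, v3]
    simp only [add_apply, sub_apply, neg_apply, smul_apply, smul_eq_mul]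
    -- the terms without derivatives of `γ` cancel because `ω` is closed
    linear_combination -(γ 3 y * hcl 0 1 2) + γ 2 y * hcl 0 1 3 - γ 1 y * hcl 0 2 3 +
      γ 0 y * hcl 1 2 3
  have hVfd : ∀ a, ContinuousOn (fun y => fderiv ℝ (V a) y (stdBasis4 a)) U := fun a y hy =>
    ((((hVc a y hy).fderiv_right (m := 0) (by norm_num)).continuousAt).clm_apply
      continuousAt_const).continuousWithinAt
  calc _ = ∫ y in U, ∑ a, partitionInChart c c y * fderiv ℝ (V a) y (stdBasis4 a) :=
        setIntegral_congr_fun hUo.measurableSet fun y hy => by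
          simp only [hdiv y hy, Finset.mul_sum]
    _ = ∑ a, -∫ y in U, fderiv ℝ (partitionInChart c c) y (stdBasis4 a) * V a y := by
        rw [integral_finsetSum _ fun a _ => integrableOn_cutoff_mul c (hVfd a)]
        exact Finset.sum_congr rfl fun a _ => integral_cutoff_mul_fderiv c _ (hVc a)
    _ = _ := by
        rw [Finset.sum_neg_distrib, ← integral_finsetSum _ fun a _ =>
          integrableOn_fderiv_cutoff_mul c (stdBasis4 a)
            fun y hy => (hVc a y hy).continuousAt.continuousWithinAt]
        simp only [fluxForm_apply]
        rfl

theorem IsSmoothFamily.fluxForm_transition (hF : IsSmoothFamily F) (k : X) {c m : X} (t : ℝ)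
    {y : E4} (hy : y ∈ chartOverlap c m) :
    fluxForm ω θ j F k c t y = (fluxForm ω θ j F k m t (chartTransition c m y)).compLinearMap
        (fderiv ℝ (chartTransition c m) y : E4 →ₗ[ℝ] E4) := by
  have h1 : differentialForm (partitionInChart k c) y =
      (differentialForm (partitionInChart k m) (chartTransition c m y)).compLinearMap
        (fderiv ℝ (chartTransition c m) y : E4 →ₗ[ℝ] E4) := by
    refine alternating_one_ext fun v => ?_
    rw [compLinearMap_one_apply, differentialForm_apply, differentialForm_apply,
      fderiv_partitionInChart_transition k hy]
    rfl
  unfold fluxForm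
  rw [hF.contractTime_transition θ j t hy, h1, algFormInChart_transition ω hy,
    ← wedge_compLinearMap_one_one]
  exact (wedge_compLinearMap_two_two _ _ _).symm

theorem IsSmoothFamily.continuousOn_fluxForm (hF : IsSmoothFamily F) (hω : IsClosedForm ω)
    (k c : X) (t : ℝ) :
    ContinuousOn (fun y => fluxForm ω θ j F k c t y stdBasis4) (extChartAt (𝓡 4) c).target := by
  have h1 := fun a => continuousOn_fderiv_partitionInChart k c (stdBasis4 a)
  have h2 := fun a b => (contDiffOn_algFormInChart hω c ![stdBasis4 a, stdBasis4 b]).continuousOn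
  have h3 : ∀ a, ContinuousOn (fun y => contractTime (θ.orbTwoForm j (familyInChart F c) (t, y))
      ![stdBasis4 a]) (extChartAt (𝓡 4) c).target := fun a y hy => by
    simp only [contractTime_apply]
    exact (ContinuousAt.comp (g := fun p => θ.orbTwoForm j (familyInChart F c) p
      ![((1 : ℝ), (0 : E4)), (0, stdBasis4 a)]) (f := fun y : E4 => (t, y))
      (hF.contDiffAt θ j hy _ _).continuousAt (by fun_prop)).continuousWithinAt
  simp only [fluxForm_apply, Fin.sum_univ_four, dualField, Matrix.cons_val]
  fun_prop

theorem sum_fluxForm (c : X) (t : ℝ) {y : E4} (hy : y ∈ (extChartAt (𝓡 4) c).target) :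
    ∑ k ∈ partitionIndex X, fluxForm ω θ j F k c t y stdBasis4 = 0 := by
  simp only [fluxForm_apply]
  rw [Finset.sum_comm]
  refine Finset.sum_eq_zero fun a _ => ?_
  rw [← Finset.sum_mul]
  have h1 : ∑ k ∈ partitionIndex X, fderiv ℝ (partitionInChart k c) y = 0 := by
    rw [← fderiv_fun_sum fun k _ =>
      (contDiffAt_partitionInChart k hy).differentiableAt (by decide)]
    simp only [sum_partitionInChart]
    simp
  rw [← sum_apply, h1]
  simp

/-- The sum over all charts of the integrals of `ω ∧ dρ_c ∧ γ` vanishes. Inserting the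
partition of unity once more, each term can be moved to another chart, where `∑ dρ_c = 0`. -/
theorem IsSmoothFamily.sum_integral_fluxForm (hX : IsOrientedAtlas X) (hF : IsSmoothFamily F)
    (hω : IsClosedForm ω) (t : ℝ) :
    ∑ c ∈ partitionIndex X, ∫ y in (extChartAt (𝓡 4) c).target,
      fluxForm ω θ j F c c t y stdBasis4 = 0 := by
  have hzero : ∀ (k c : X) (y : E4), partitionInChart k c =ᶠ[𝓝 y] 0 →
      fluxForm ω θ j F k c t y stdBasis4 = 0 := fun k c y h => by
    rw [fluxForm_apply, h.fderiv_eq]; simp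
  have h1 : ∀ c ∈ partitionIndex X, ∫ y in (extChartAt (𝓡 4) c).target,
      fluxForm ω θ j F c c t y stdBasis4 = ∑ m ∈ partitionIndex X,
        ∫ y in (extChartAt (𝓡 4) m).target,
          partitionInChart m m y * fluxForm ω θ j F c m t y stdBasis4 := by
    intro c _
    have hint : ∀ m ∈ partitionIndex X, IntegrableOn (fun y => partitionInChart m c y *
        fluxForm ω θ j F c c t y stdBasis4) (extChartAt (𝓡 4) c).target := fun m _ =>
      integrableOn_of_continuousOn_of_eq_zero (isOpen_extChartAt_target c)
        (isCompact_cutoffSupport c) (cutoffSupport_subset c)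
        ((continuousOn_partitionInChart m c).mul (hF.continuousOn_fluxForm θ j hω c c t))
        fun y hy hK => by rw [hzero c c y (cutoff_eventually_zero hy hK), mul_zero]
    calc _ = ∫ y in (extChartAt (𝓡 4) c).target, ∑ m ∈ partitionIndex X,
          partitionInChart m c y * fluxForm ω θ j F c c t y stdBasis4 := by
          simp only [← Finset.sum_mul, sum_partitionInChart, one_mul]
      _ = ∑ m ∈ partitionIndex X, ∫ y in (extChartAt (𝓡 4) c).target,
          partitionInChart m c y * fluxForm ω θ j F c c t y stdBasis4 :=
          integral_finsetSum _ hint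
      _ = _ := Finset.sum_congr rfl fun m _ => ?_
    refine integral_chart_change hX c m
      (D := fun y => partitionInChart m c y • fluxForm ω θ j F c c t y)
      (D' := fun y => partitionInChart m m y • fluxForm ω θ j F c m t y) ?_ ?_ ?_
    · intro y hy
      rw [hF.fluxForm_transition θ j c t hy, partitionInChart_transition m hy]
      rfl
    · intro y hy hy'
      rw [AlternatingMap.smul_apply,
        (partitionInChart_eventually_zero_of_notMem_overlap hy hy').self_of_nhds]
      simp
    · intro y hy hy'
      rw [AlternatingMap.smul_apply,
        hzero c m y (partitionInChart_eventually_zero_of_notMem_overlap hy hy'), smul_zero]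
  rw [Finset.sum_congr rfl h1, Finset.sum_comm]
  refine Finset.sum_eq_zero fun m _ => ?_
  rw [← integral_finsetSum _ fun c _ =>
    integrableOn_cutoff_mul m (hF.continuousOn_fluxForm θ j hω c m t)]
  rw [setIntegral_congr_fun (g := fun _ => (0 : ℝ)) (isOpen_extChartAt_target m).measurableSet]
  · simp
  · intro y hy
    simp only [← Finset.mul_sum, sum_fluxForm θ j m t hy, mul_zero]

/-- The integral of `ω ∧ F_t^*Θⱼ` is stationary along a smooth family. -/
theorem IsSmoothFamily.hasDerivAt_pairing (hX : IsOrientedAtlas X) (hF : IsSmoothFamily F)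
    (hω : IsClosedForm ω) (t : ℝ) :
    HasDerivAt (fun t => ∑ c ∈ partitionIndex X, ∫ y in (extChartAt (𝓡 4) c).target,
      partitionInChart c c y * pairingDensity ω θ j (F t) c y) 0 t := by
  have h : HasDerivAt (fun t => ∑ c ∈ partitionIndex X, ∫ y in (extChartAt (𝓡 4) c).target,
      partitionInChart c c y * pairingDensity ω θ j (F t) c y)
      (∑ c ∈ partitionIndex X, ∫ y in (extChartAt (𝓡 4) c).target, partitionInChart c c y *
        fderiv ℝ (fun p : ℝ × E4 => pairingDensity ω θ j (F p.1) c p.2) (t, y) (1, 0)) t := by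
    refine HasDerivAt.fun_sum fun c _ => ?_
    refine hasDerivAt_integral_mul_of_contDiffAt
      (b := fun p : ℝ × E4 => pairingDensity ω θ j (F p.1) c p.2) (isOpen_extChartAt_target c)
      (isCompact_cutoffSupport c) (cutoffSupport_subset c) (continuousOn_partitionInChart c c)
      (fun y hy hK => cutoff_eq_zero hy hK) (fun s y hy => ?_) t
    exact hF.contDiffAt_pairingDensity θ j hω hy
  have h0 : (∑ c ∈ partitionIndex X, ∫ y in (extChartAt (𝓡 4) c).target, partitionInChart c c y *
      fderiv ℝ (fun p : ℝ × E4 => pairingDensity ω θ j (F p.1) c p.2) (t, y) (1, 0)) = 0 := by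
    simp only [hF.integral_cutoff_time θ j hω]
    rw [Finset.sum_neg_distrib, hF.sum_integral_fluxForm θ j hX hω t, neg_zero]
  rwa [h0] at h

end Family

section Homotopy

variable {X : Type*} [TopologicalSpace X] [ChartedSpace E4 X] [IsManifold (𝓡 4) ∞ X]

/-- A homotopy, reparametrised by a smooth step function so that it becomes constant near
both ends and extends to all times. -/
def homotopyFamily (F : SmoothOrbMap ((𝓡∂ 1).prod (𝓡 4)) (unitInterval × X)) (t : ℝ) (x : X) :
    TorusQuot :=
  F.toFun (projIcc 0 1 zero_le_one (Real.smoothTransition t), x)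

theorem isSmoothFamily_homotopyFamily
    (F : SmoothOrbMap ((𝓡∂ 1).prod (𝓡 4)) (unitInterval × X)) :
    IsSmoothFamily (homotopyFamily F) := by
  intro c t y hy
  let κ : ℝ × E4 → unitInterval × X := fun p =>
    (projIcc 0 1 zero_le_one (Real.smoothTransition p.1), (extChartAt (𝓡 4) c).symm p.2)
  have h1 : ContMDiff 𝓘(ℝ, ℝ) (𝓡∂ 1) ∞
      (fun t : ℝ => (projIcc 0 1 zero_le_one (Real.smoothTransition t) : unitInterval)) := by
    rw [← contMDiffOn_univ]
    exact (contMDiffOn_projIcc (x := (0 : ℝ)) (y := 1)).comp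
      (Real.smoothTransition.contDiff.contMDiff.contMDiffOn)
      fun t _ => ⟨Real.smoothTransition.nonneg t, Real.smoothTransition.le_one t⟩
  have hκ : ContMDiffAt 𝓘(ℝ, ℝ × E4) ((𝓡∂ 1).prod (𝓡 4)) ∞ κ (t, y) := by
    refine ContMDiffAt.prodMk ?_ ?_
    · exact h1.contMDiffAt.comp (t, y) contDiffAt_fst.contMDiffAt
    · exact ContMDiffAt.comp (t, y) (contMDiffAt_extChartAt_symm (y := (t, y).2) hy)
        contDiffAt_snd.contMDiffAt
  obtain ⟨h2, h3⟩ := F.lift_spec (κ (t, y))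
  refine ⟨F.lift (κ (t, y)) ∘ κ, ?_, ?_⟩
  · exact (contMDiffAt_iff_contDiffAt.1 (h2.comp (t, y) hκ)).of_le (by decide)
  · exact hκ.continuousAt.eventually h3

variable [CompactSpace X] [T2Space X]

theorem SmoothOrbMap.pairing_eq_of_homotopic (hX : IsOrientedAtlas X) (θ : TorusCoframe)
    {ω : Fin 3 → (x : X) → (TangentSpace (𝓡 4) x) [⋀^Fin 2]→L[ℝ] ℝ}
    (hω : ∀ i, IsClosedForm (ω i)) {f₀ f₁ : SmoothOrbMap (𝓡 4) X} (h : f₀.Homotopic f₁)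
    (i j : Fin 3) : f₀.pairing ω θ i j = f₁.pairing ω θ i j := by
  obtain ⟨F, h0, h1⟩ := h
  have hF := isSmoothFamily_homotopyFamily F
  have e0 : homotopyFamily F 0 = f₀.toFun := by
    funext x; rw [← h0 x, homotopyFamily]; simp
  have e1 : homotopyFamily F 1 = f₁.toFun := by
    funext x; rw [← h1 x, homotopyFamily]; simp
  have hd := fun t => hF.hasDerivAt_pairing θ j hX (hω i) t
  have := is_const_of_deriv_eq_zero (fun t => (hd t).differentiableAt) (fun t => (hd t).deriv) 0 1
  rw [f₀.pairing_eq, f₁.pairing_eq, ← e0, ← e1]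
  exact this

end Homotopy

end

end

theorem mainTheorem2 {X : Type*} [TopologicalSpace X] [ChartedSpace E4 X] [IsManifold (𝓡 4) ∞ X]
    [CompactSpace X] [T2Space X] (hX : IsOrientedAtlas X) (θ : TorusCoframe)
    (ω : Fin 3 → (x : X) → (TangentSpace (𝓡 4) x) [⋀^Fin 2]→L[ℝ] ℝ)
    (hω : ∀ i, IsClosedForm (ω i)) :
    (∀ f₀ f₁ : SmoothOrbMap (𝓡 4) X, f₀.Homotopic f₁ →
      ∀ i j : Fin 3, f₀.pairing ω θ i j = f₁.pairing ω θ i j) ∧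
    (IsHyperKahlerTriple ω → ∀ f : SmoothOrbMap (𝓡 4) X,
      ∑ i, f.pairing ω θ i i ≤ f.energy (fun x => tripleMetric (tripleAt ω x)) θ) :=
  ⟨fun _ _ h i j => SmoothOrbMap.pairing_eq_of_homotopic hX θ hω h i j,
    fun h f => f.sum_pairing_le_energy h θ⟩
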